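/- Let $\nu\ge 1$ be an integer, $\epsilon\in\{1,-1\}$, $\kappa_1,\dots,\kappa_{\nu+1}>0$, and put $\epsilon_i=(-1)^{i-1}\epsilon$. Let $\mathcal L^\epsilon_{\nu,\kappa}$ be the class of continuous maps $g:[-1,1]\to\mathbb R$ for which there are $s>0$ and $-1=c_0<c_1<\dots<c_\nu<c_{\nu+1}=1$ such that $g|_{[c_{i-1},c_i]}$ is affine with slope $\epsilon_i\kappa_i s$ for $1\le i\le \nu+1$, and $g(-1)=-\epsilon_1$, $g(1)=\epsilon_{\nu+1}$. Let $g\in\mathcal L^\epsilon_{\nu,\kappa}$ be such that every turning point $c_1,\dots,c_\nu$ is periodic or eventually periodic (so that its forward orbit is defined and stays in $[-1,1]$). Assume that $g$ is ergodic for Lebesgue measure, i.e. if $A,B\subset[-1,1]$ are Borel sets of positive Lebesgue measure with $g(A)\subset A$, $g(B)\subset B$, then $A\cap B$ has positive Lebesgue measure. Let $P_0=\{c_1,\dots,c_\nu\}$, $P=\bigcup_{k\ge 0}g^k(P_0)$ (a finite set), $\mathbf c_1=(g(c_1),\dots,g(c_\nu))$, and let $\rho>0$ satisfy $2\rho\le|x-y|$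 for all distinct $x,y\in P$. Put $U=\bigcup_{x\in P\setminus P_0}U_x$ where $U_x=\{z\in\mathbb C:|z-x|<\rho\}$. For $w=(w_1,\dots,w_\nu)\in\mathbb C^\nu$ put $w_0=-\epsilon_1$, $w_{\nu+1}=\epsilon_{\nu+1}$, $$S(w)=\sum_{i=1}^{\nu+1}\frac{(w_i-w_{i-1})\epsilon_i}{2\kappa_i},\qquad p_j(w)=-1+\sum_{i=1}^{j}\frac{(w_i-w_{i-1})\epsilon_i}{\kappa_i S(w)}\quad(0\le j\le\nu+1).$$ For $x\in P\setminus P_0$ with $x\in[c_{i-1},c_i]$ and $z\in U_x$ put $G_w(z)=w_{i-1}+\kappa_i\epsilon_iS(w)\,(z-p_{i-1}(w))$; extend $g$ to $U$ by the affine formula of the branch containing $x$ on each $U_x$. Let $W\subset\mathbb C^\nu$ be a connected open set, invariant under complex conjugation, with $\mathbf c_1\in W$ and $S\ne0$ on $W$. Put $\mathbf p=(p_1,\dots,p_\nu)$. Then $g$ is a real marked map: $P$ is a finite set of real numbers containing $P_0$, $g(P)\subset P$, $U\supset P\setminus P_0$ is open and conjugation-invariant, $g|_U$ is holomorphic and commutes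 with conjugation, and $g'\neq 0$ on $P\setminus P_0$. Also $(g,G,\mathbf p)_W$ is a real local holomorphic deformation of $g$: $\mathbf p$ is holomorphic on $W$, $(w,z)\mapsto G_w(z)$ is holomorphic on $W\times U$, $\mathbf p(\mathbf c_1)=(c_1,\dots,c_\nu)$, $G_{\mathbf c_1}=g$ on $U$, and $\mathbf p$, $G$ commute with complex conjugation. And the positively oriented transversality property holds, which means the following. For each $j$, if some $g^k(c_j)$ with $k\ge1$ lies in $P_0$, let $q_j$ be the least such $k$, let $\mu(j)$ be given by $g^{q_j}(c_j)=c_{\mu(j)}$, and put $R_j(w)=G_w^{q_j-1}(w_j)-p_{\mu(j)}(w)$; otherwise let $q_j$ be the least integer for which there is $1\le l_j<q_j$ with $g^{q_j}(c_j)=g^{l_j}(c_j)$, and put $R_j(w)=G_w^{q_j-1}(w_j)-G_w^{l_j-1}(w_j)$. Then $\mathcal R=(R_1,\dots,R_\nu)$ is (complex) differentiable at $\mathbf c_1$, and the number $$\frac{\det D\mathcal R(\mathbf c_1)}{\prod_{j=1}^{\nu}Dg^{q_j-1}(g(c_j))}$$ is real and strictly positive. -/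

import Mathlib

open Set MeasureTheory

noncomputable section

namespace MarkedMap

variable {ν : ℕ}

/-- `g` is a real marked map on `{c₀ⱼ} ∪ U`, with distinct distinguished points `c₀ⱼ` and finite
forward invariant set `P ⊆ ℝ`. Values of `g` outside `{c₀ⱼ} ∪ U` play no role. -/
structure IsRealMarkedMap (g : ℂ → ℂ) (c₀ : Fin ν → ℂ) (P U : Set ℂ) : Prop where
  injective : Function.Injective c₀
  finite : P.Finite
  range_subset : range c₀ ⊆ P
  mapsTo : MapsTo g P P
  isOpen : IsOpen U
  diff_subset : P \ range c₀ ⊆ U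
  differentiableOn : DifferentiableOn ℂ g U
  deriv_ne_zero : ∀ x ∈ P \ range c₀, deriv g x ≠ 0
  real_points : ∀ x ∈ P, x.im = 0
  conj_mem : ∀ z ∈ U, (starRingEnd ℂ) z ∈ U
  map_conj : ∀ z ∈ U, g ((starRingEnd ℂ) z) = (starRingEnd ℂ) (g z)

/-- The vector `𝐜₁ = (g(c₀₁), …, g(c₀ᵥ))`. -/
def critVal (g : ℂ → ℂ) (c₀ : Fin ν → ℂ) : Fin ν → ℂ := fun j => g (c₀ j)

/-- `(g, G, 𝐩)_W` is a real local holomorphic deformation of `g`. -/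
structure IsRealLocalHolomorphicDeformation (g : ℂ → ℂ) (c₀ : Fin ν → ℂ) (U : Set ℂ)
    (G : (Fin ν → ℂ) → ℂ → ℂ) (p : (Fin ν → ℂ) → Fin ν → ℂ) (W : Set (Fin ν → ℂ)) : Prop where
  isOpen : IsOpen W
  isConnected : IsConnected W
  critVal_mem : critVal g c₀ ∈ W
  differentiableOn_p : DifferentiableOn ℂ p W
  p_critVal : p (critVal g c₀) = c₀
  differentiableOn_G : DifferentiableOn ℂ (fun a : (Fin ν → ℂ) × ℂ => G a.1 a.2) (W ×ˢ U)
  G_critVal : EqOn (G (critVal g c₀)) g U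
  conj_mem : ∀ w ∈ W, (fun j => (starRingEnd ℂ) (w j)) ∈ W
  G_conj : ∀ w ∈ W, ∀ z ∈ U,
    G (fun j => (starRingEnd ℂ) (w j)) ((starRingEnd ℂ) z) = (starRingEnd ℂ) (G w z)
  p_conj : ∀ w ∈ W, ∀ j, p (fun i => (starRingEnd ℂ) (w i)) j = (starRingEnd ℂ) (p w j)

open Classical in
/-- The integer `qⱼ`: the first `k ≥ 1` with `gᵏ(c₀ⱼ)` in `P₀ = {c₀₁, …, c₀ᵥ}` if there is one;
otherwise the least `q` such that `g^q(c₀ⱼ) = g^l(c₀ⱼ)` for some `1 ≤ l < q`. -/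
def critTime (g : ℂ → ℂ) (c₀ : Fin ν → ℂ) (j : Fin ν) : ℕ :=
  if ∃ k, 1 ≤ k ∧ g^[k] (c₀ j) ∈ range c₀ then
    sInf {k | 1 ≤ k ∧ g^[k] (c₀ j) ∈ range c₀}
  else
    sInf {q | ∃ l, 1 ≤ l ∧ l < q ∧ g^[q] (c₀ j) = g^[l] (c₀ j)}

/-- The integer `lⱼ` (used only when the forward orbit of `g(c₀ⱼ)` avoids `P₀`). -/
def critPreTime (g : ℂ → ℂ) (c₀ : Fin ν → ℂ) (j : Fin ν) : ℕ :=
  sInf {l | 1 ≤ l ∧ l < critTime g c₀ j ∧ g^[critTime g c₀ j] (c₀ j) = g^[l] (c₀ j)}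

open Classical in
/-- The map `𝓡 = (R₁, …, Rᵥ)`: `Rⱼ(w) = G_w^{qⱼ-1}(wⱼ) - p_{μ(j)}(w)` when
`g^{qⱼ}(c₀ⱼ) = c₀_{μ(j)}`, and `Rⱼ(w) = G_w^{qⱼ-1}(wⱼ) - G_w^{lⱼ-1}(wⱼ)` otherwise. -/
def relationMap (g : ℂ → ℂ) (c₀ : Fin ν → ℂ) (G : (Fin ν → ℂ) → ℂ → ℂ)
    (p : (Fin ν → ℂ) → Fin ν → ℂ) (w : Fin ν → ℂ) (j : Fin ν) : ℂ :=
  (G w)^[critTime g c₀ j - 1] (w j) -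
    if h : ∃ m, g^[critTime g c₀ j] (c₀ j) = c₀ m then p w h.choose
    else (G w)^[critPreTime g c₀ j - 1] (w j)

/-- The Jacobian matrix `D𝓡(𝐜₁)`. -/
def jacobian (g : ℂ → ℂ) (c₀ : Fin ν → ℂ) (G : (Fin ν → ℂ) → ℂ → ℂ)
    (p : (Fin ν → ℂ) → Fin ν → ℂ) : Matrix (Fin ν) (Fin ν) ℂ :=
  Matrix.of fun j k => fderiv ℂ (relationMap g c₀ G p) (critVal g c₀) (Pi.single k 1) j

/-- The quotient `det D𝓡(𝐜₁) / ∏ⱼ Dg^{qⱼ-1}(c₁ⱼ)`. -/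
def transversalityRatio (g : ℂ → ℂ) (c₀ : Fin ν → ℂ) (G : (Fin ν → ℂ) → ℂ → ℂ)
    (p : (Fin ν → ℂ) → Fin ν → ℂ) : ℂ :=
  (jacobian g c₀ G p).det / ∏ j, deriv (g^[critTime g c₀ j - 1]) (critVal g c₀ j)

/-- The positively oriented transversality property: the relation map is differentiable at `𝐜₁`
and the above quotient is a positive real number. -/
def PositivelyOrientedTransversal (g : ℂ → ℂ) (c₀ : Fin ν → ℂ) (G : (Fin ν → ℂ) → ℂ → ℂ)
    (p : (Fin ν → ℂ) → Fin ν → ℂ) : Prop :=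
  DifferentiableAt ℂ (relationMap g c₀ G p) (critVal g c₀) ∧
    (transversalityRatio g c₀ G p).im = 0 ∧ 0 < (transversalityRatio g c₀ G p).re

end MarkedMap

namespace PiecewiseLinear

variable {ν : ℕ}

/-- The sign of the slope on the branch with (zero-based) index `i`, that is `(-1)^i ε`. -/
def branchSign (ε : ℝ) (i : Fin (ν + 1)) : ℝ := (-1) ^ (i : ℕ) * ε

/-- `g` restricted to `[-1,1]` belongs to the class `𝓛^ε_{ν,κ}`, with slope parameter `s` and
partition `-1 = c 0 < c 1 < ⋯ < c (ν+1) = 1`. Values of `g` outside `[-1,1]` play no role. -/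
structure IsInClass (ε : ℝ) (κ : Fin (ν + 1) → ℝ) (s : ℝ) (c : Fin (ν + 2) → ℝ)
    (g : ℝ → ℝ) : Prop where
  s_pos : 0 < s
  strictMono : StrictMono c
  c_zero : c 0 = -1
  c_last : c (Fin.last (ν + 1)) = 1
  affine : ∀ i : Fin (ν + 1), ∀ x ∈ Icc (c i.castSucc) (c i.succ),
    g x = g (c i.castSucc) + branchSign ε i * κ i * s * (x - c i.castSucc)
  left_end : g (-1) = -branchSign ε (0 : Fin (ν + 1))
  right_end : g 1 = branchSign ε (Fin.last ν)

/-- The `j`-th turning point (`j = 0, …, ν-1`), that is the partition point `c (j+1)`. -/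
def turn (c : Fin (ν + 2) → ℝ) (j : Fin ν) : ℝ := c j.succ.castSucc

/-- `x` is periodic or eventually periodic for `g|[-1,1]`; in particular its whole forward orbit
is defined, that is, stays in `[-1,1]`. -/
def IsPrePeriodic (g : ℝ → ℝ) (x : ℝ) : Prop :=
  (∀ n, g^[n] x ∈ Icc (-1 : ℝ) 1) ∧ ∃ m, g^[m] x ∈ Function.periodicPts g

/-- `g` is ergodic with respect to Lebesgue measure on `[-1,1]`: two (forward) invariant Borel sets
of positive measure always meet in a set of positive measure. -/
def IsErgodic (g : ℝ → ℝ) : Prop :=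
  ∀ A B : Set ℝ, A ⊆ Icc (-1) 1 → B ⊆ Icc (-1) 1 → MeasurableSet A → MeasurableSet B →
    MapsTo g A A → MapsTo g B B → 0 < volume A → 0 < volume B → 0 < volume (A ∩ B)

/-- The union `P` of the forward orbits of the turning points. -/
def postSet (g : ℝ → ℝ) (c : Fin (ν + 2) → ℝ) : Set ℝ :=
  {x | ∃ (j : Fin ν) (k : ℕ), x = g^[k] (turn c j)}

/-- The index of the branch containing `t`: the number of turning points that are at most `t`. -/
def branchIdx (c : Fin (ν + 2) → ℝ) (t : ℝ) : Fin (ν + 1) :=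
  ⟨(Finset.univ.filter fun j : Fin ν => turn c j ≤ t).card,
    Nat.lt_succ_of_le ((Finset.card_filter_le _ _).trans (by simp))⟩

/-- The complex extension of `g`: on each vertical strip over a branch it is the affine map
of that branch. It agrees with `g` on `[-1,1]`. -/
def complexMap (ε : ℝ) (κ : Fin (ν + 1) → ℝ) (s : ℝ) (c : Fin (ν + 2) → ℝ) (g : ℝ → ℝ)
    (z : ℂ) : ℂ :=
  (g (c (branchIdx c z.re).castSucc) : ℂ) +
    ((branchSign ε (branchIdx c z.re) * κ (branchIdx c z.re) * s : ℝ) : ℂ) *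
      (z - (c (branchIdx c z.re).castSucc : ℂ))

/-- The vector `(w₀, w₁, …, wᵥ, wᵥ₊₁)` with `w₀ = -ε₁` and `wᵥ₊₁ = εᵥ₊₁`. -/
def extend (ε : ℝ) (w : Fin ν → ℂ) : Fin (ν + 2) → ℂ :=
  Fin.cons (α := fun _ => ℂ) (-(branchSign ε (0 : Fin (ν + 1)) : ℂ))
    (Fin.snoc (α := fun _ => ℂ) w (branchSign ε (Fin.last ν) : ℂ))

/-- `S(w) = ∑ᵢ (wᵢ - wᵢ₋₁) εᵢ / (2 κᵢ)`. -/
def slope (ε : ℝ) (κ : Fin (ν + 1) → ℝ) (w : Fin ν → ℂ) : ℂ :=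
  ∑ i : Fin (ν + 1), (extend ε w i.succ - extend ε w i.castSucc) * (branchSign ε i : ℂ) /
    (2 * (κ i : ℂ))

/-- The partition points `p_j(w) = -1 + ∑_{i ≤ j} (wᵢ - wᵢ₋₁) εᵢ / (κᵢ S(w))`, `0 ≤ j ≤ ν + 1`. -/
def partitionPt (ε : ℝ) (κ : Fin (ν + 1) → ℝ) (w : Fin ν → ℂ) (j : Fin (ν + 2)) : ℂ :=
  -1 + ∑ i : Fin (ν + 1) with i.castSucc < j,
    (extend ε w i.succ - extend ε w i.castSucc) * (branchSign ε i : ℂ) / (κ i : ℂ) / slope ε κ w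

/-- The map `𝐩(w) = (p₁(w), …, pᵥ(w))`. -/
def turnMap (ε : ℝ) (κ : Fin (ν + 1) → ℝ) (w : Fin ν → ℂ) (j : Fin ν) : ℂ :=
  partitionPt ε κ w j.succ.castSucc

/-- The map `G_w`: near a point of the `i`-th branch of `g`, it is the affine map
`z ↦ wᵢ₋₁ + κᵢ εᵢ S(w) (z - pᵢ₋₁(w))`. -/
def family (ε : ℝ) (κ : Fin (ν + 1) → ℝ) (c : Fin (ν + 2) → ℝ) (w : Fin ν → ℂ) (z : ℂ) : ℂ :=
  extend ε w (branchIdx c z.re).castSucc +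
    (κ (branchIdx c z.re) : ℂ) * (branchSign ε (branchIdx c z.re) : ℂ) * slope ε κ w *
      (z - partitionPt ε κ w (branchIdx c z.re).castSucc)

/-- The turning points as complex numbers. -/
def turnC (c : Fin (ν + 2) → ℝ) (j : Fin ν) : ℂ := (turn c j : ℂ)

/-- The set `P`, as a subset of `ℂ`. -/
def postSetC (g : ℝ → ℝ) (c : Fin (ν + 2) → ℝ) : Set ℂ := (fun x : ℝ => (x : ℂ)) '' postSet g c

/-- The neighbourhood `U = ⋃_{x ∈ P \ P₀} U_x`, where `U_x` is the disc of radius `ρ` at `x`. -/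
def nbhd (g : ℝ → ℝ) (c : Fin (ν + 2) → ℝ) (ρ : ℝ) : Set ℂ :=
  ⋃ x ∈ postSetC g c \ range (turnC c), Metric.ball x ρ

end PiecewiseLinear

end

noncomputable section

namespace PiecewiseLinear

/-! ### Branches of the map and their indices. -/

section

variable {ν : ℕ}

/-! Divide the `j`-th row of the Jacobian by the multiplier of `g^(q_j - 1)` at the `j`-th turning
value. The ratio to be shown positive is then the determinant of real linear forms, `relationForm`
at `t = 1`. These forms are polynomial in a parameter `t` that weights each step of the orbit, and
at `t = 0` they are the coordinate forms, with determinant `1`. By the intermediate value theorem it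
is enough that they have no common kernel for `0 < t ≤ 1` (`eq_zero_of_relationForm_eq_zero`,
`det_relationForm_pos`).

A kernel vector `w` gives a vector field over the finite orbits. It starts at a turning point with
`t` times the derivative of `p_j` along `w` and is transported by `v ↦ ∂_w G_w(x) + g'(x) v / t`
(`fieldMap`). Vanishing of the forms says exactly that the orbits close up, so the field lives on a
finite invariant set `T` of pairs, with value `0` over both endpoints. Since all slopes of `G_w` are
proportional to `S(w)`, a chord of slope `φ` over an interval inside one branch is sent to a chord
of slope `α + φ / t`, where `α` is the derivative of `S` along `w` divided by `s`
(`slopeSystem_orbitField`).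

Let `M ≥ 0` be the largest chord slope. A chord of slope `M` between neighbouring points lies in one
branch, so `α + M / t ≤ M` and `α ≤ 0`; the opposite field gives `α ≥ 0`. Hence `α = 0`, and `M = 0`
if `t < 1`. If `t = 1`, the intervals of largest slope and those of smallest slope form two
invariant sets of positive measure. Ergodicity makes them share an interval, so the two slopes agree
and both vanish. This needs the field to be single-valued, which also follows from ergodicity
(`snd_eq_of_fst_eq`). A field with all slopes zero vanishes, and its value at the `j`-th turning
value is `w_j`, so `w = 0`.

What remains is to identify the forms with derivatives, through the restriction of the family to
complex lines in real directions. -/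

theorem branchIdx_eq_of_forall {c : Fin (ν + 2) → ℝ} {t : ℝ} {i : Fin (ν + 1)}
    (h : ∀ j : Fin ν, turn c j ≤ t ↔ (j : ℕ) < i) : branchIdx c t = i := by
  apply Fin.ext
  simp only [branchIdx, h]
  rw [Fin.card_filter_val_lt]
  have := i.is_lt
  omega

theorem turn_le_iff {c : Fin (ν + 2) → ℝ} (hc : StrictMono c) {t : ℝ} {i : Fin (ν + 1)}
    (h₁ : c i.castSucc ≤ t) (h₂ : t < c i.succ ∨ i = Fin.last ν) (j : Fin ν) :
    turn c j ≤ t ↔ (j : ℕ) < i := by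
  constructor
  · intro h
    by_contra hji
    rcases h₂ with h₂ | rfl
    · have : c i.succ ≤ turn c j := hc.monotone (by
        rw [Fin.le_def]; simp; omega)
      linarith
    · have := j.is_lt
      simp at hji
  · intro h
    refine le_trans (hc.monotone ?_) h₁
    rw [Fin.le_def]; simp; omega

/-- Branches are taken half-open, so a turning point belongs to the branch on its right; only the
last branch keeps its right endpoint. -/
theorem branchIdx_eq {c : Fin (ν + 2) → ℝ} (hc : StrictMono c) {t : ℝ} {i : Fin (ν + 1)}
    (h₁ : c i.castSucc ≤ t) (h₂ : t < c i.succ ∨ i = Fin.last ν) : branchIdx c t = i :=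
  branchIdx_eq_of_forall (turn_le_iff hc h₁ h₂)

theorem branchIdx_spec {c : Fin (ν + 2) → ℝ} (hc : StrictMono c) {t : ℝ} (h₀ : c 0 ≤ t) :
    c (branchIdx c t).castSucc ≤ t ∧
      (t < c (branchIdx c t).succ ∨ branchIdx c t = Fin.last ν) := by
  obtain ⟨i, hi, hmax⟩ := Finset.exists_max_image
    (Finset.univ.filter fun i : Fin (ν + 1) => c i.castSucc ≤ t) (fun i => i)
    ⟨0, by simpa using h₀⟩
  have hi' : c i.castSucc ≤ t := by simpa using hi
  have h₂ : t < c i.succ ∨ i = Fin.last ν := by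
    by_contra hcon
    push Not at hcon
    obtain ⟨h1, h2⟩ := hcon
    have hlt : (i : ℕ) < ν := by
      have := i.is_lt
      have h3 : (i : ℕ) ≠ ν := fun h => h2 (Fin.ext h)
      omega
    have := hmax ⟨i + 1, by omega⟩ (Finset.mem_filter.2 ⟨Finset.mem_univ _, h1⟩)
    rw [Fin.le_def] at this
    simp at this
  rw [branchIdx_eq hc hi' h₂]
  exact ⟨hi', h₂⟩

/-- The slope of the branch with index `i`. -/
def branchSlope (ε : ℝ) (κ : Fin (ν + 1) → ℝ) (s : ℝ) (i : Fin (ν + 1)) : ℝ :=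
  branchSign ε i * κ i * s

theorem branchSign_mul_self {ε : ℝ} (hε : ε = 1 ∨ ε = -1) (i : Fin (ν + 1)) :
    branchSign ε i * branchSign ε i = 1 := by
  have h : ε * ε = 1 := by rcases hε with rfl | rfl <;> norm_num
  have h' : ((-1 : ℝ) ^ (i : ℕ)) * (-1) ^ (i : ℕ) = 1 := by
    rw [← mul_pow]; norm_num
  unfold branchSign
  linear_combination ε * ε * h' + h

theorem branchSign_ne_zero {ε : ℝ} (hε : ε = 1 ∨ ε = -1) (i : Fin (ν + 1)) :
    branchSign ε i ≠ 0 := fun h => by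
  have := branchSign_mul_self hε i
  simp [h] at this

namespace IsInClass

variable {ε : ℝ} {κ : Fin (ν + 1) → ℝ} {s : ℝ} {c : Fin (ν + 2) → ℝ} {g : ℝ → ℝ}

theorem branchSlope_ne_zero (hg : IsInClass ε κ s c g) (hε : ε = 1 ∨ ε = -1)
    (hκ : ∀ i, 0 < κ i) (i : Fin (ν + 1)) : branchSlope ε κ s i ≠ 0 :=
  mul_ne_zero (mul_ne_zero (branchSign_ne_zero hε i) (hκ i).ne') hg.s_pos.ne'

theorem map_sub (hg : IsInClass ε κ s c g) (i : Fin (ν + 1)) {x y : ℝ}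
    (hx : x ∈ Icc (c i.castSucc) (c i.succ)) (hy : y ∈ Icc (c i.castSucc) (c i.succ)) :
    g x - g y = branchSlope ε κ s i * (x - y) := by
  rw [hg.affine i x hx, hg.affine i y hy, branchSlope]; ring

theorem mem_branch (hg : IsInClass ε κ s c g) {x : ℝ} (hx : x ∈ Icc (-1 : ℝ) 1) :
    x ∈ Icc (c (branchIdx c x).castSucc) (c (branchIdx c x).succ) := by
  have := branchIdx_spec hg.strictMono (t := x) (by rw [hg.c_zero]; exact hx.1)
  refine ⟨this.1, ?_⟩
  rcases this.2 with h | h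
  · exact h.le
  · rw [h, Fin.succ_last, hg.c_last]; exact hx.2

theorem turn_strictMono (hg : IsInClass ε κ s c g) : StrictMono (turn c) := by
  intro i j h
  apply hg.strictMono
  rw [Fin.lt_def] at *
  simpa using h

theorem turn_mem_Ioo (hg : IsInClass ε κ s c g) (j : Fin ν) : turn c j ∈ Ioo (-1 : ℝ) 1 := by
  rw [← hg.c_zero, ← hg.c_last]
  constructor <;> apply hg.strictMono <;> rw [Fin.lt_def] <;> simp

theorem eq_ends_or_turn (hg : IsInClass ε κ s c g) (i : Fin (ν + 2)) :
    c i = -1 ∨ c i = 1 ∨ ∃ j : Fin ν, i = j.succ.castSucc := by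
  induction i using Fin.cases with
  | zero => exact Or.inl hg.c_zero
  | succ i =>
    induction i using Fin.lastCases with
    | last => right; left; rw [Fin.succ_last]; exact hg.c_last
    | cast i => right; right; exact ⟨i, by simp [Fin.castSucc_succ]⟩

theorem complexMap_ofReal (hg : IsInClass ε κ s c g) {x : ℝ} (hx : x ∈ Icc (-1 : ℝ) 1) :
    complexMap ε κ s c g x = (g x : ℂ) := by
  have := hg.affine _ x (hg.mem_branch hx)
  rw [complexMap, Complex.ofReal_re, this]
  push_cast; ring

end IsInClass

end

/-! ### Slope systems and their extremal chords. -/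

section

variable {ν : ℕ}

/-- A finite set of pairs `(x, y)`, thought of as a (possibly multivalued) vector field on a finite
`g`-invariant set of points, such that slopes of chords inside a branch are transformed by
`φ ↦ α + φ / t`. -/
structure SlopeSystem (g : ℝ → ℝ) (c : Fin (ν + 2) → ℝ) (σ : Fin (ν + 1) → ℝ) (t α : ℝ)
    (T : Finset (ℝ × ℝ)) : Prop where
  left_mem : ((-1, 0) : ℝ × ℝ) ∈ T
  right_mem : ((1, 0) : ℝ × ℝ) ∈ T
  fst_mem : ∀ z ∈ T, z.1 ∈ Icc (-1 : ℝ) 1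
  turn_mem : ∀ i, ∃ z ∈ T, z.1 = c i
  image : ∀ i, ∀ z ∈ T, ∀ z' ∈ T, z.1 ∈ Icc (c i.castSucc) (c i.succ) →
    z'.1 ∈ Icc (c i.castSucc) (c i.succ) → ∃ u ∈ T, ∃ u' ∈ T, u.1 = g z.1 ∧ u'.1 = g z'.1 ∧
      u'.2 - u.2 = σ i * ((z'.1 - z.1) * α + (z'.2 - z.2) / t)

/-- The pair `z, z'` is a chord of slope `M`. -/
def IsChord (T : Finset (ℝ × ℝ)) (M : ℝ) (z z' : ℝ × ℝ) : Prop :=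
  z ∈ T ∧ z' ∈ T ∧ z.1 < z'.1 ∧ z'.2 - z.2 = M * (z'.1 - z.1)

/-- `M` is the largest slope of a chord. -/
def IsMaxSlope (T : Finset (ℝ × ℝ)) (M : ℝ) : Prop :=
  (∀ z ∈ T, ∀ z' ∈ T, z.1 < z'.1 → z'.2 - z.2 ≤ M * (z'.1 - z.1)) ∧ ∃ z z', IsChord T M z z'

/-- The union of the intervals spanned by the chords of slope `M`. -/
def slopeSet (T : Finset (ℝ × ℝ)) (M : ℝ) : Set ℝ :=
  {x | ∃ z z', IsChord T M z z' ∧ x ∈ Icc z.1 z'.1}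

/-- A point of `T` splitting a chord of slope `M` leaves two chords of slope at most `M`, hence of
slope exactly `M`. So a shortest such chord around `x` has no point of `T` over its interior. -/
theorem IsMaxSlope.exists_consecutive {T : Finset (ℝ × ℝ)} {M x : ℝ} (hM : IsMaxSlope T M)
    (hx : x ∈ slopeSet T M) :
    ∃ a b, IsChord T M a b ∧ x ∈ Icc a.1 b.1 ∧ ∀ z ∈ T, z.1 ∉ Ioo a.1 b.1 := by
  classical
  obtain ⟨a₀, b₀, h₀, hx₀⟩ := hx
  obtain ⟨⟨a, b⟩, hab, hmin⟩ := Finset.exists_min_image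
    ((T ×ˢ T).filter fun p => IsChord T M p.1 p.2 ∧ x ∈ Icc p.1.1 p.2.1)
    (fun p => p.2.1 - p.1.1)
    ⟨(a₀, b₀), by simp only [Finset.mem_filter, Finset.mem_product]; exact ⟨⟨h₀.1, h₀.2.1⟩, h₀, hx₀⟩⟩
  simp only [Finset.mem_filter, Finset.mem_product, Prod.forall] at hab hmin
  obtain ⟨⟨ha, hb⟩, hch, hxab⟩ := hab
  refine ⟨a, b, hch, hxab, fun z hz hzab => ?_⟩
  have h1 := hM.1 a ha z hz hzab.1
  have h2 := hM.1 z hz b hb hzab.2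
  have h3 := hch.2.2.2
  rcases le_total x z.1 with h | h
  · have := hmin a.1 a.2 z.1 z.2 ⟨⟨ha, hz⟩, ⟨ha, hz, hzab.1, by simp; linarith⟩, ⟨hxab.1, h⟩⟩
    linarith [hzab.2]
  · have := hmin z.1 z.2 b.1 b.2 ⟨⟨hz, hb⟩, ⟨hz, hb, hzab.2, by simp; linarith⟩, ⟨h, hxab.2⟩⟩
    linarith [hzab.1]

namespace SlopeSystem

variable {ε : ℝ} {κ : Fin (ν + 1) → ℝ} {s : ℝ} {c : Fin (ν + 2) → ℝ} {g : ℝ → ℝ} {t α M : ℝ}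
  {T : Finset (ℝ × ℝ)}

/-- This symmetry turns statements about the largest slope into statements about the smallest one.
-/
theorem neg {σ : Fin (ν + 1) → ℝ} (hT : SlopeSystem g c σ t α T) :
    SlopeSystem g c σ t (-α) (T.image fun z => (z.1, -z.2)) where
  left_mem := Finset.mem_image.2 ⟨_, hT.left_mem, by simp⟩
  right_mem := Finset.mem_image.2 ⟨_, hT.right_mem, by simp⟩
  fst_mem := by
    intro z hz
    obtain ⟨w, hw, rfl⟩ := Finset.mem_image.1 hz
    exact hT.fst_mem w hw
  turn_mem i := by
    obtain ⟨z, hz, h⟩ := hT.turn_mem i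
    exact ⟨_, Finset.mem_image_of_mem _ hz, h⟩
  image i := by
    intro z hz z' hz' h h'
    obtain ⟨w, hw, rfl⟩ := Finset.mem_image.1 hz
    obtain ⟨w', hw', rfl⟩ := Finset.mem_image.1 hz'
    obtain ⟨u, hu, u', hu', h1, h2, h3⟩ := hT.image i w hw w' hw' h h'
    refine ⟨_, Finset.mem_image_of_mem _ hu, _, Finset.mem_image_of_mem _ hu', h1, h2, ?_⟩
    simp only
    linear_combination -h3

/-- Nonnegativity comes from the chord joining the two endpoints, whose slope is `0`. -/
theorem exists_isMaxSlope {σ : Fin (ν + 1) → ℝ} (hT : SlopeSystem g c σ t α T) :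
    ∃ M, IsMaxSlope T M ∧ 0 ≤ M := by
  classical
  obtain ⟨⟨a, b⟩, hab, hmax⟩ := Finset.exists_max_image
    ((T ×ˢ T).filter fun p => p.1.1 < p.2.1) (fun p => (p.2.2 - p.1.2) / (p.2.1 - p.1.1))
    ⟨((-1, 0), (1, 0)), by simp [hT.left_mem, hT.right_mem]⟩
  simp only [Finset.mem_filter, Finset.mem_product, Prod.forall] at hab hmax
  have h1 : ∀ z ∈ T, ∀ z' ∈ T, z.1 < z'.1 →
      z'.2 - z.2 ≤ (b.2 - a.2) / (b.1 - a.1) * (z'.1 - z.1) := by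
    intro z hz z' hz' h
    have := hmax z.1 z.2 z'.1 z'.2 ⟨⟨hz, hz'⟩, h⟩
    rwa [div_le_iff₀ (by linarith)] at this
  refine ⟨(b.2 - a.2) / (b.1 - a.1), ⟨h1, a, b, hab.1.1, hab.1.2, hab.2, ?_⟩, ?_⟩
  · have : b.1 - a.1 ≠ 0 := by linarith [hab.2]
    field_simp
  · have := h1 _ hT.left_mem _ hT.right_mem (by norm_num)
    norm_num at this
    linarith

/-- Every partition point lies under a point of `T`, so an interval free of `T` cannot cross one. -/
theorem exists_branch {σ : Fin (ν + 1) → ℝ} (hT : SlopeSystem g c σ t α T)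
    (hg : IsInClass ε κ s c g) {a b : ℝ} (ha : a ∈ Icc (-1 : ℝ) 1) (hb : b ∈ Icc (-1 : ℝ) 1)
    (h : ∀ z ∈ T, z.1 ∉ Ioo a b) :
    ∃ i : Fin (ν + 1), Icc a b ⊆ Icc (c i.castSucc) (c i.succ) := by
  have := branchIdx_spec hg.strictMono (t := a) (by rw [hg.c_zero]; exact ha.1)
  refine ⟨branchIdx c a, Icc_subset_Icc this.1 ?_⟩
  rcases this.2 with h' | h'
  · obtain ⟨z, hz, hzc⟩ := hT.turn_mem (branchIdx c a).succ
    have := h z hz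
    rw [hzc] at this
    by_contra hcon
    exact this ⟨h', not_le.1 hcon⟩
  · rw [h', Fin.succ_last, hg.c_last]; exact hb.2

section
variable (hT : SlopeSystem g c (branchSlope ε κ s) t α T) (hg : IsInClass ε κ s c g)
  (hε : ε = 1 ∨ ε = -1) (hκ : ∀ i, 0 < κ i)
include hT hg hε hκ

theorem exists_image_chord {a b : ℝ × ℝ} (hab : IsChord T M a b)
    (h : ∀ z ∈ T, z.1 ∉ Ioo a.1 b.1) :
    ∃ u v, IsChord T (α + M / t) u v ∧ ∀ x ∈ Icc a.1 b.1, g x ∈ Icc u.1 v.1 := by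
  obtain ⟨ha, hb, hlt, hM⟩ := hab
  obtain ⟨i, hi⟩ := hT.exists_branch hg (hT.fst_mem a ha) (hT.fst_mem b hb) h
  have hai := hi (left_mem_Icc.2 hlt.le)
  have hbi := hi (right_mem_Icc.2 hlt.le)
  obtain ⟨u, hu, u', hu', h1, h2, h3⟩ := hT.image i a ha b hb hai hbi
  have h4 := hg.map_sub i hbi hai
  have h5 : u'.2 - u.2 = (α + M / t) * (u'.1 - u.1) := by
    rw [h3, h1, h2, h4, hM]; ring
  -- On a decreasing branch the image chord has its endpoints swapped; its slope is unaffected.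
  rcases lt_or_gt_of_ne (hg.branchSlope_ne_zero hε hκ i) with hσ | hσ
  · refine ⟨u', u, ⟨hu', hu, ?_, by linarith⟩, fun x hx => ?_⟩
    · rw [h1, h2]; nlinarith
    · have h6 := hg.map_sub i (hi hx) hai
      have h7 := hg.map_sub i (hi hx) hbi
      rw [h1, h2]
      constructor <;> nlinarith [hx.1, hx.2]
  · refine ⟨u, u', ⟨hu, hu', ?_, by linarith⟩, fun x hx => ?_⟩
    · rw [h1, h2]; nlinarith
    · have h6 := hg.map_sub i (hi hx) hai
      have h7 := hg.map_sub i (hi hx) hbi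
      rw [h1, h2]
      constructor <;> nlinarith [hx.1, hx.2]

theorem add_div_le (hM : IsMaxSlope T M) : α + M / t ≤ M := by
  obtain ⟨a₀, b₀, h₀⟩ := hM.2
  obtain ⟨a, b, hab, -, hcon⟩ :=
    hM.exists_consecutive ⟨a₀, b₀, h₀, left_mem_Icc.2 h₀.2.2.1.le⟩
  obtain ⟨u, v, huv, -⟩ := hT.exists_image_chord hg hε hκ hab hcon
  have := hM.1 u huv.1 v huv.2.1 huv.2.2.1
  rw [huv.2.2.2] at this
  exact le_of_mul_le_mul_right this (by linarith [huv.2.2.1])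

/-- From `α + M / t ≤ M` and `M ≤ M / t`, the latter because `M ≥ 0` and `t ≤ 1`. -/
theorem alpha_nonpos (ht : 0 < t) (ht' : t ≤ 1) : α ≤ 0 := by
  obtain ⟨M, hM, hM0⟩ := hT.exists_isMaxSlope
  have := hT.add_div_le hg hε hκ hM
  have h2 : M ≤ M / t := le_div_self hM0 ht ht'
  linarith

theorem alpha_eq_zero (ht : 0 < t) (ht' : t ≤ 1) : α = 0 :=
  le_antisymm (hT.alpha_nonpos hg hε hκ ht ht')
    (by linarith [hT.neg.alpha_nonpos hg hε hκ ht ht'])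

theorem maxSlope_eq_zero_of_lt (ht : 0 < t) (ht' : t < 1) (hM : IsMaxSlope T M) (hM0 : 0 ≤ M) :
    M = 0 := by
  have h1 := hT.add_div_le hg hε hκ hM
  rw [hT.alpha_eq_zero hg hε hκ ht ht'.le, zero_add, div_le_iff₀ ht] at h1
  nlinarith

end

theorem slopeSet_subset {σ : Fin (ν + 1) → ℝ} (hT : SlopeSystem g c σ t α T) (M : ℝ) :
    slopeSet T M ⊆ Icc (-1) 1 := by
  rintro x ⟨a, b, hab, hx⟩
  exact ⟨(hT.fst_mem a hab.1).1.trans hx.1, hx.2.trans (hT.fst_mem b hab.2.1).2⟩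

theorem _root_.PiecewiseLinear.measurableSet_slopeSet (T : Finset (ℝ × ℝ)) (M : ℝ) :
    MeasurableSet (slopeSet T M) := by
  classical
  have : slopeSet T M = ⋃ p ∈ (T ×ˢ T).filter (fun p => IsChord T M p.1 p.2),
      Icc p.1.1 p.2.1 := by
    ext x
    simp only [slopeSet, mem_ofPred_eq, mem_iUnion, Finset.mem_filter, Finset.mem_product]
    constructor
    · rintro ⟨a, b, h, hx⟩
      exact ⟨(a, b), ⟨⟨h.1, h.2.1⟩, h⟩, hx⟩
    · rintro ⟨p, h, hx⟩
      exact ⟨p.1, p.2, h.2, hx⟩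
  rw [this]
  exact Finset.measurableSet_biUnion _ fun _ _ => measurableSet_Icc

theorem _root_.PiecewiseLinear.IsMaxSlope.volume_slopeSet_pos (hM : IsMaxSlope T M) :
    0 < volume (slopeSet T M) := by
  obtain ⟨a, b, h⟩ := hM.2
  refine lt_of_lt_of_le ?_ (measure_mono (show Icc a.1 b.1 ⊆ _ from fun x hx => ⟨a, b, h, hx⟩))
  rw [Real.volume_Icc]
  simpa using h.2.2.1

/-- For `t = 1` and `α = 0` slopes are preserved, so a consecutive chord of slope `M` covering `x`
maps to a chord of slope `M` covering `g x`. -/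
theorem mapsTo_slopeSet (hT : SlopeSystem g c (branchSlope ε κ s) 1 0 T)
    (hg : IsInClass ε κ s c g) (hε : ε = 1 ∨ ε = -1) (hκ : ∀ i, 0 < κ i)
    (hM : IsMaxSlope T M) : MapsTo g (slopeSet T M) (slopeSet T M) := by
  intro x hx
  obtain ⟨a, b, hab, hxab, hcon⟩ := hM.exists_consecutive hx
  obtain ⟨u, v, huv, h⟩ := hT.exists_image_chord hg hε hκ hab hcon
  rw [zero_add, div_one] at huv
  exact ⟨u, v, huv, h x hxab⟩

end SlopeSystem

/-! ### Affinely mapped families of intervals contradict ergodicity. -/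

/-- The points of `(x, x')` or `(x', x)` closer than `r |x' - x|` to the midpoint, for the pairs
`(x, x')` in `E`. -/
def middleSet (E : Set (ℝ × ℝ)) : Set ℝ :=
  {z | ∃ p ∈ E, |z - (p.1 + p.2) / 2| < |p.2 - p.1| / 4}

/-- The points of the intervals spanned by pairs in `E` outside the closed middle halves. -/
def outerSet (E : Set (ℝ × ℝ)) : Set ℝ :=
  {z | ∃ p ∈ E, |p.2 - p.1| / 4 < |z - (p.1 + p.2) / 2| ∧
    |z - (p.1 + p.2) / 2| < |p.2 - p.1| / 2}

theorem isOpen_middleSet (E : Set (ℝ × ℝ)) : IsOpen (middleSet E) := by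
  have : middleSet E = ⋃ p ∈ E, {z | |z - (p.1 + p.2) / 2| < |p.2 - p.1| / 4} := by
    ext; simp [middleSet]
  rw [this]
  exact isOpen_biUnion fun p _ => isOpen_lt (by fun_prop) continuous_const

theorem isOpen_outerSet (E : Set (ℝ × ℝ)) : IsOpen (outerSet E) := by
  have : outerSet E = ⋃ p ∈ E, ({z | |p.2 - p.1| / 4 < |z - (p.1 + p.2) / 2|} ∩
      {z | |z - (p.1 + p.2) / 2| < |p.2 - p.1| / 2}) := by
    ext; simp [outerSet, and_left_comm]
  rw [this]
  exact isOpen_biUnion fun p _ => (isOpen_lt continuous_const (by fun_prop)).inter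
    (isOpen_lt (by fun_prop) continuous_const)

theorem mem_Ioo_of_abs_sub_midpoint_lt {x x' z : ℝ} (h : |z - (x + x') / 2| < |x' - x| / 2) :
    z ∈ Ioo (min x x') (max x x') := by
  rw [abs_lt] at h
  rcases le_total x x' with h' | h'
  · rw [abs_of_nonneg (by linarith)] at h
    rw [min_eq_left h', max_eq_right h']
    constructor <;> linarith
  · rw [abs_of_nonpos (by linarith)] at h
    rw [min_eq_right h', max_eq_left h']
    constructor <;> linarith

/-- An ergodic map does not permute affinely a family of intervals with endpoints in a set `Q`
that does not meet their interiors. -/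
theorem not_isErgodic_of_pairs {g : ℝ → ℝ} {Q : Set ℝ} {E : Set (ℝ × ℝ)} (hne : E.Nonempty)
    (hQ : Q ⊆ Icc (-1) 1) (hE : ∀ p ∈ E, p.1 ∈ Q ∧ p.2 ∈ Q ∧ p.1 ≠ p.2)
    (hcon : ∀ p ∈ E, ∀ x ∈ Q, x ∉ Ioo (min p.1 p.2) (max p.1 p.2))
    (hmap : ∀ p ∈ E, (g p.1, g p.2) ∈ E)
    (haff : ∀ p ∈ E, ∃ k : ℝ, ∀ z ∈ Icc (min p.1 p.2) (max p.1 p.2),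
      g z - g p.1 = k * (z - p.1)) : ¬ IsErgodic g := by
  intro herg
  -- Affine maps send midpoints to midpoints and scale distances to them by the same factor as
  -- lengths, so both the middle and the outer parts are forward invariant.
  have key : ∀ p ∈ E, ∀ z, |z - (p.1 + p.2) / 2| < |p.2 - p.1| / 2 →
      ∃ k : ℝ, k ≠ 0 ∧ |g p.2 - g p.1| = |k| * |p.2 - p.1| ∧
        |g z - (g p.1 + g p.2) / 2| = |k| * |z - (p.1 + p.2) / 2| := by
    intro p hp z hz
    obtain ⟨k, hk⟩ := haff p hp
    have h2 := hk p.2 ⟨min_le_right _ _, le_max_right _ _⟩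
    have hz' := hk z (Ioo_subset_Icc_self (mem_Ioo_of_abs_sub_midpoint_lt hz))
    refine ⟨k, ?_, by rw [h2, abs_mul], ?_⟩
    · rintro rfl
      exact (hE _ (hmap p hp)).2.2 (by simp only; linarith)
    · rw [← abs_mul]
      congr 1
      linear_combination hz' - h2 / 2
  have hsub : ∀ p ∈ E, ∀ z, |z - (p.1 + p.2) / 2| < |p.2 - p.1| / 2 → z ∈ Icc (-1 : ℝ) 1 := by
    intro p hp z hz
    have h := mem_Ioo_of_abs_sub_midpoint_lt hz
    have h1 := hQ (hE p hp).1
    have h2 := hQ (hE p hp).2.1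
    exact ⟨(le_min h1.1 h2.1).trans h.1.le, h.2.le.trans (max_le h1.2 h2.2)⟩
  have hpos : ∀ p ∈ E, 0 < |p.2 - p.1| := fun p hp =>
    abs_pos.2 (sub_ne_zero.2 (hE p hp).2.2.symm)
  -- Since endpoints avoid interiors, two intervals with overlapping interiors coincide; within one
  -- interval the middle and outer parts are disjoint.
  have hdisj : middleSet E ∩ outerSet E = ∅ := by
    rw [eq_empty_iff_forall_notMem]
    rintro z ⟨⟨p, hp, h⟩, q, hq, h1, h2⟩
    have h3 := mem_Ioo_of_abs_sub_midpoint_lt (h.trans_le (by linarith [hpos p hp]))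
    have h4 := mem_Ioo_of_abs_sub_midpoint_lt h2
    have hmin : ∀ r ∈ E, min r.1 r.2 ∈ Q ∧ max r.1 r.2 ∈ Q := by
      intro r hr
      obtain ⟨h5, h6, -⟩ := hE r hr
      constructor
      · rcases min_choice r.1 r.2 with h | h <;> rw [h] <;> assumption
      · rcases max_choice r.1 r.2 with h | h <;> rw [h] <;> assumption
    have e1 : min p.1 p.2 = min q.1 q.2 := by
      rcases lt_trichotomy (min p.1 p.2) (min q.1 q.2) with h' | h' | h'
      · exact absurd ⟨h', h4.1.trans h3.2⟩ (hcon p hp _ (hmin q hq).1)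
      · exact h'
      · exact absurd ⟨h', h3.1.trans h4.2⟩ (hcon q hq _ (hmin p hp).1)
    have e2 : max p.1 p.2 = max q.1 q.2 := by
      rcases lt_trichotomy (max p.1 p.2) (max q.1 q.2) with h' | h' | h'
      · exact absurd ⟨h4.1.trans h3.2, h'⟩ (hcon q hq _ (hmin p hp).2)
      · exact h'
      · exact absurd ⟨h3.1.trans h4.2, h'⟩ (hcon p hp _ (hmin q hq).2)
    have e3 : p.1 + p.2 = q.1 + q.2 := by
      rw [← min_add_max p.1 p.2, e1, e2, min_add_max]
    have e4 : |p.2 - p.1| = |q.2 - q.1| := by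
      rw [← max_sub_min_eq_abs, ← max_sub_min_eq_abs, e1, e2]
    rw [e3, e4] at h
    exact lt_asymm h h1
  have h := herg (middleSet E) (outerSet E)
    (fun z ⟨p, hp, h⟩ => hsub p hp z (h.trans_le (by linarith [hpos p hp])))
    (fun z ⟨p, hp, _, h⟩ => hsub p hp z h)
    (isOpen_middleSet E).measurableSet (isOpen_outerSet E).measurableSet
    (fun z ⟨p, hp, h⟩ => by
      obtain ⟨k, hk, h1, h2⟩ := key p hp z (h.trans_le (by linarith [hpos p hp]))
      refine ⟨_, hmap p hp, ?_⟩
      simp only [h1, h2]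
      nlinarith [abs_pos.2 hk])
    (fun z ⟨p, hp, h, h'⟩ => by
      obtain ⟨k, hk, h1, h2⟩ := key p hp z h'
      refine ⟨_, hmap p hp, ?_⟩
      simp only [h1, h2]
      constructor <;> nlinarith [abs_pos.2 hk])
    ((isOpen_middleSet E).measure_pos _ (by
      obtain ⟨p, hp⟩ := hne
      refine ⟨(p.1 + p.2) / 2, p, hp, ?_⟩
      simp only [sub_self, abs_zero]
      linarith [hpos p hp]))
    ((isOpen_outerSet E).measure_pos _ (by
      obtain ⟨p, hp⟩ := hne
      have := hpos p hp
      refine ⟨(p.1 + p.2) / 2 + 3 / 8 * (p.2 - p.1), p, hp, ?_⟩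
      rw [add_sub_cancel_left, abs_mul, abs_of_pos (by norm_num : (0 : ℝ) < 3 / 8)]
      constructor <;> linarith))
  rw [hdisj] at h
  simp at h

/-! ### Vanishing of slope systems of ergodic maps. -/

namespace SlopeSystem

variable {ε : ℝ} {κ : Fin (ν + 1) → ℝ} {s : ℝ} {c : Fin (ν + 2) → ℝ} {g : ℝ → ℝ} {t α M : ℝ}
  {T : Finset (ℝ × ℝ)}

section
variable (hT : SlopeSystem g c (branchSlope ε κ s) 1 α T) (hg : IsInClass ε κ s c g)
  (hε : ε = 1 ∨ ε = -1) (hκ : ∀ i, 0 < κ i) (herg : IsErgodic g)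
include hT hg hε hκ herg

/-- When `t = 1`, the gap between two values over one point is multiplied by the absolute slope of
the branch (the `α` term drops out), just as lengths in that branch are. So the ratio of a gap to
the distance to another point of `T` is preserved within a branch, and the pairs with the largest
ratio span intervals that `g` maps affinely to one another, against ergodicity. -/
theorem snd_eq_of_fst_eq {z z' : ℝ × ℝ} (hz : z ∈ T) (hz' : z' ∈ T) (h : z.1 = z'.1) :
    z.2 = z'.2 := by
  classical
  by_contra hne
  have hend : ∃ x ∈ T, x.1 ≠ z.1 := by
    by_cases h1 : z.1 = -1
    · exact ⟨_, hT.right_mem, by rw [h1]; norm_num⟩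
    · exact ⟨_, hT.left_mem, fun h' => h1 h'.symm⟩
  obtain ⟨x₀, hx₀, hx₀z⟩ := hend
  obtain ⟨⟨y, y', x⟩, hm, hmax⟩ := Finset.exists_max_image
    ((T ×ˢ T ×ˢ T).filter fun p => p.1.1 = p.2.1.1 ∧ p.2.2.1 ≠ p.1.1)
    (fun p => |p.2.1.2 - p.1.2| / |p.2.2.1 - p.1.1|)
    ⟨(z, z', x₀), by simp [hz, hz', hx₀, h]; rwa [← h]⟩
  simp only [Finset.mem_filter, Finset.mem_product] at hm hmax
  set D := |y'.2 - y.2| / |x.1 - y.1| with hD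
  have hDpos : 0 < D := by
    refine lt_of_lt_of_le ?_ (hmax (z, z', x₀) ⟨⟨hz, hz', hx₀⟩, h, hx₀z⟩)
    exact div_pos (abs_pos.2 (sub_ne_zero.2 (Ne.symm hne))) (abs_pos.2 (sub_ne_zero.2 hx₀z))
  let E : Set (ℝ × ℝ) := {p | p.1 ≠ p.2 ∧ ∃ u ∈ T, ∃ u' ∈ T, ∃ v ∈ T, u.1 = p.1 ∧ u'.1 = p.1 ∧
    v.1 = p.2 ∧ |u'.2 - u.2| = D * |p.2 - p.1|}
  have hle : ∀ u ∈ T, ∀ u' ∈ T, ∀ v ∈ T, u.1 = u'.1 → |u'.2 - u.2| ≤ D * |v.1 - u.1| ∨ v.1 = u.1 := by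
    intro u hu u' hu' v hv h
    by_cases h' : v.1 = u.1
    · exact Or.inr h'
    · have := hmax (u, u', v) ⟨⟨hu, hu', hv⟩, h, h'⟩
      rw [div_le_iff₀ (abs_pos.2 (sub_ne_zero.2 h'))] at this
      exact Or.inl this
  -- A point strictly between would be nearer to `p.1` and give a ratio larger than `D`.
  have hcon : ∀ p ∈ E, ∀ w ∈ T, w.1 ∉ Ioo (min p.1 p.2) (max p.1 p.2) := by
    rintro p ⟨hp, u, hu, u', hu', v, hv, h1, h2, h3, h4⟩ w hw hwp
    have hlt : |w.1 - p.1| < |p.2 - p.1| := by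
      rcases le_total p.1 p.2 with h' | h'
      · rw [min_eq_left h', max_eq_right h'] at hwp
        rw [abs_of_pos (by linarith [hwp.1]), abs_of_nonneg (by linarith)]
        linarith [hwp.2]
      · rw [min_eq_right h', max_eq_left h'] at hwp
        rw [abs_of_neg (by linarith [hwp.2]), abs_of_nonpos (by linarith)]
        linarith [hwp.1]
    rcases hle u hu u' hu' w hw (h1.trans h2.symm) with h5 | h5
    · rw [h4, h1] at h5
      have := le_of_mul_le_mul_left h5 hDpos
      linarith
    · rw [h5, h1] at hwp
      rcases le_total p.1 p.2 with h' | h'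
      · rw [min_eq_left h'] at hwp; exact lt_irrefl _ hwp.1
      · rw [max_eq_left h'] at hwp; exact lt_irrefl _ hwp.2
  have hbr : ∀ p ∈ E, ∃ i : Fin (ν + 1),
      Icc (min p.1 p.2) (max p.1 p.2) ⊆ Icc (c i.castSucc) (c i.succ) := by
    intro p hp
    have hc := hcon p hp
    obtain ⟨hne, u, hu, u', hu', v, hv, h1, h2, h3, h4⟩ := hp
    have hp1 := h1 ▸ hT.fst_mem u hu
    have hp2 := h3 ▸ hT.fst_mem v hv
    refine hT.exists_branch hg ⟨le_min hp1.1 hp2.1, (min_le_left _ _).trans hp1.2⟩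
      ⟨hp1.1.trans (le_max_left _ _), max_le hp1.2 hp2.2⟩ hc
  refine not_isErgodic_of_pairs (g := g) (Q := Prod.fst '' (T : Set (ℝ × ℝ))) (E := E)
    ⟨(y.1, x.1), Ne.symm hm.2.2, y, hm.1.1, y', hm.1.2.1, x, hm.1.2.2, rfl, hm.2.1.symm, rfl, ?_⟩
    ?_ ?_ ?_ ?_ ?_ herg
  · rw [hD, div_mul_cancel₀]
    exact abs_ne_zero.2 (sub_ne_zero.2 hm.2.2)
  · rintro _ ⟨u, hu, rfl⟩
    exact hT.fst_mem u hu
  · rintro p ⟨hp, u, hu, u', hu', v, hv, h1, h2, h3, h4⟩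
    exact ⟨⟨u, hu, h1⟩, ⟨v, hv, h3⟩, hp⟩
  · rintro p hp _ ⟨w, hw, rfl⟩
    exact hcon p hp w hw
  · intro p hpE
    obtain ⟨i, hi⟩ := hbr p hpE
    obtain ⟨hp, u, hu, u', hu', v, hv, h1, h2, h3, h4⟩ := hpE
    have hi1 := hi ⟨min_le_left _ _, le_max_left _ _⟩
    have hi2 := hi ⟨min_le_right _ _, le_max_right _ _⟩
    have hσ := hg.branchSlope_ne_zero hε hκ i
    have hsub := hg.map_sub i hi2 hi1
    obtain ⟨a, ha, a', ha', ha1, ha2, ha3⟩ := hT.image i u hu u' hu' (h1 ▸ hi1) (h2 ▸ hi1)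
    obtain ⟨b, hb, b', hb', hb1, hb2, -⟩ := hT.image i u hu v hv (h1 ▸ hi1) (h3 ▸ hi2)
    have hne' : g p.1 ≠ g p.2 := by
      intro h'
      rw [h', sub_self] at hsub
      rcases mul_eq_zero.1 hsub.symm with h'' | h''
      · exact hσ h''
      · exact hp (by linarith)
    refine ⟨hne', a, ha, a', ha', b', hb', by rw [ha1, h1], by rw [ha2, h2], by rw [hb2, h3], ?_⟩
    simp only
    rw [ha3, hsub, h1, h2, sub_self, zero_mul, zero_add, div_one, abs_mul, abs_mul, h4]
    ring
  · intro p hpE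
    obtain ⟨i, hi⟩ := hbr p hpE
    exact ⟨branchSlope ε κ s i, fun z hz =>
      hg.map_sub i (hi hz) (hi ⟨min_le_left _ _, le_max_left _ _⟩)⟩

end

section
variable (hT : SlopeSystem g c (branchSlope ε κ s) t α T) (hg : IsInClass ε κ s c g)
  (hε : ε = 1 ∨ ε = -1) (hκ : ∀ i, 0 < κ i) (herg : IsErgodic g)
include hT hg hε hκ herg

theorem maxSlope_eq_zero_of_eq_one (ht : t = 1) {M' : ℝ} (hM : IsMaxSlope T M) (hM0 : 0 ≤ M)
    (hM' : IsMaxSlope (T.image fun z => (z.1, -z.2)) M') (hM0' : 0 ≤ M') : M = 0 ∧ M' = 0 := by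
  subst ht
  obtain rfl : α = 0 := hT.alpha_eq_zero hg hε hκ one_pos le_rfl
  have hneg := hT.neg
  rw [neg_zero] at hneg
  have hpos := herg _ _ (hT.slopeSet_subset M) (hneg.slopeSet_subset M')
    (measurableSet_slopeSet _ _) (measurableSet_slopeSet _ _) (hT.mapsTo_slopeSet hg hε hκ hM)
    (hneg.mapsTo_slopeSet hg hε hκ hM') hM.volume_slopeSet_pos hM'.volume_slopeSet_pos
  -- A set of positive measure contains a point outside the finite base of `T`. The consecutive
  -- chords of the two extremal slopes around that point span the same gap of the base;
  -- single-valuedness then makes them the same chord, so `M = -M'`.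
  have hnot : ¬ (slopeSet T M ∩ slopeSet (T.image fun z => (z.1, -z.2)) M' ⊆
      (T.image Prod.fst : Finset ℝ)) := fun h => by
    have := (measure_mono h).trans_eq ((Finset.finite_toSet (T.image Prod.fst)).measure_zero volume)
    exact absurd hpos (not_lt.2 this)
  obtain ⟨x, ⟨hx, hx'⟩, hxT⟩ := not_subset.1 hnot
  have hxT : ∀ z ∈ T, z.1 ≠ x := fun z hz h =>
    hxT (by rw [← h]; exact Finset.mem_image_of_mem _ hz)
  obtain ⟨a, b, ⟨ha, hb, hab, hch⟩, hxab, hcon⟩ := hM.exists_consecutive hx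
  obtain ⟨a', b', ⟨ha', hb', hab', hch'⟩, hxab', hcon'⟩ := hM'.exists_consecutive hx'
  obtain ⟨u, hu, rfl⟩ := Finset.mem_image.1 ha'
  obtain ⟨v, hv, rfl⟩ := Finset.mem_image.1 hb'
  simp only at hab' hch' hxab' hcon'
  have hcon'' : ∀ z ∈ T, z.1 ∉ Ioo u.1 v.1 := fun z hz =>
    hcon' (z.1, -z.2) (Finset.mem_image_of_mem (fun z => (z.1, -z.2)) hz)
  have l1 := lt_of_le_of_ne hxab.1 (hxT a ha)
  have l2 := lt_of_le_of_ne hxab.2 (hxT b hb).symm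
  have l3 := lt_of_le_of_ne hxab'.1 (hxT u hu)
  have l4 := lt_of_le_of_ne hxab'.2 (hxT v hv).symm
  have e1 : a.1 = u.1 := by
    rcases lt_trichotomy a.1 u.1 with h | h | h
    · exact absurd ⟨h, l3.trans l2⟩ (hcon u hu)
    · exact h
    · exact absurd ⟨h, l1.trans l4⟩ (hcon'' a ha)
  have e2 : b.1 = v.1 := by
    rcases lt_trichotomy b.1 v.1 with h | h | h
    · exact absurd ⟨l3.trans l2, h⟩ (hcon'' b hb)
    · exact h
    · exact absurd ⟨l1.trans l4, h⟩ (hcon v hv)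
  have e3 := hT.snd_eq_of_fst_eq hg hε hκ herg ha hu e1
  have e4 := hT.snd_eq_of_fst_eq hg hε hκ herg hb hv e2
  have h0 : (M + M') * (b.1 - a.1) = 0 := by
    rw [e1, e2] at hch ⊢
    rw [e3, e4] at hch
    linear_combination -hch - hch'
  have h0 : M + M' = 0 := by
    rcases mul_eq_zero.1 h0 with h | h
    · exact h
    · linarith
  constructor <;> linarith

/-- A slope system of an ergodic map with parameter `0 < t ≤ 1` vanishes. -/
theorem snd_eq_zero (ht : 0 < t) (ht' : t ≤ 1) {z : ℝ × ℝ} (hz : z ∈ T) : z.2 = 0 := by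
  obtain ⟨M, hM, hM0⟩ := hT.exists_isMaxSlope
  obtain ⟨M', hM', hM0'⟩ := hT.neg.exists_isMaxSlope
  have h : M = 0 ∧ M' = 0 := by
    rcases ht'.lt_or_eq with h | h
    · exact ⟨hT.maxSlope_eq_zero_of_lt hg hε hκ ht h hM hM0,
        hT.neg.maxSlope_eq_zero_of_lt hg hε hκ ht h hM' hM0'⟩
    · exact hT.maxSlope_eq_zero_of_eq_one hg hε hκ herg h hM hM0 hM' hM0'
  obtain ⟨rfl, rfl⟩ := h
  -- Both extremal slopes are zero, so values over distinct points agree; comparison with an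
  -- endpoint other than `z.1` gives `0`.
  have key : ∀ a ∈ T, ∀ b ∈ T, a.1 < b.1 → b.2 = a.2 := by
    intro a ha b hb hab
    have h1 := hM.1 a ha b hb hab
    have h2 := hM'.1 _ (Finset.mem_image_of_mem _ ha) _ (Finset.mem_image_of_mem _ hb) hab
    simp only at h2
    linarith
  rcases (hT.fst_mem z hz).1.lt_or_eq with h | h
  · exact key _ hT.left_mem z hz h
  · exact (key z hz _ hT.right_mem (by rw [← h]; norm_num)).symm

end
end SlopeSystem

end

/-! ### Linear forms: formal derivatives of the family and of the relations. -/

section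

variable {ν : ℕ}

theorem sum_filter_castSucc_lt_succ {M : Type*} [AddCommMonoid M] (f : Fin (ν + 1) → M)
    (i : Fin (ν + 1)) :
    ∑ k : Fin (ν + 1) with k.castSucc < i.succ, f k =
      ∑ k : Fin (ν + 1) with k.castSucc < i.castSucc, f k + f i := by
  classical
  have : (Finset.univ.filter fun k : Fin (ν + 1) => k.castSucc < i.succ) =
      insert i (Finset.univ.filter fun k : Fin (ν + 1) => k.castSucc < i.castSucc) := by
    ext k
    simp only [Finset.mem_filter, Finset.mem_univ, true_and, Finset.mem_insert,
      Fin.castSucc_lt_castSucc_iff, Fin.castSucc_lt_succ_iff, le_iff_eq_or_lt]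
  rw [this, Finset.sum_insert (by simp), add_comm]

theorem filter_castSucc_lt_zero :
    (Finset.univ.filter fun k : Fin (ν + 1) => k.castSucc < (0 : Fin (ν + 2))) = ∅ := by
  simp

theorem filter_castSucc_lt_last :
    (Finset.univ.filter fun k : Fin (ν + 1) => k.castSucc < Fin.last (ν + 1)) = Finset.univ := by
  simp [Fin.castSucc_lt_last]

theorem sum_filter_castSucc_sub {M : Type*} [AddCommGroup M] (f : Fin (ν + 2) → M)
    (j : Fin (ν + 2)) :
    ∑ k : Fin (ν + 1) with k.castSucc < j, (f k.succ - f k.castSucc) = f j - f 0 := by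
  induction j using Fin.induction with
  | zero => rw [filter_castSucc_lt_zero]; simp
  | succ i ih => rw [sum_filter_castSucc_lt_succ, ih]; abel

/-- The derivative of `extend`, as a family of linear forms. -/
def extendForm : Fin (ν + 2) → ((Fin ν → ℝ) →ₗ[ℝ] ℝ) :=
  Fin.cons (α := fun _ => (Fin ν → ℝ) →ₗ[ℝ] ℝ) 0
    (Fin.snoc (α := fun _ => (Fin ν → ℝ) →ₗ[ℝ] ℝ) (fun j => LinearMap.proj j) 0)

theorem extendForm_zero : extendForm (0 : Fin (ν + 2)) = 0 := rfl

theorem extendForm_last : extendForm (Fin.last (ν + 1)) = 0 := by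
  rw [← Fin.succ_last, extendForm, Fin.cons_succ, Fin.snoc_last]

theorem extendForm_turn (j : Fin ν) : extendForm j.succ.castSucc = LinearMap.proj j := by
  rw [Fin.castSucc_succ, extendForm, Fin.cons_succ, Fin.snoc_castSucc]

/-- The derivative of `slope`. -/
def slopeForm (ε : ℝ) (κ : Fin (ν + 1) → ℝ) : (Fin ν → ℝ) →ₗ[ℝ] ℝ :=
  ∑ i : Fin (ν + 1), (branchSign ε i / (2 * κ i)) • (extendForm i.succ - extendForm i.castSucc)

/-- The derivative of `partitionPt` at the vector of critical values. -/
def ptForm (ε : ℝ) (κ : Fin (ν + 1) → ℝ) (s : ℝ) (c : Fin (ν + 2) → ℝ) (j : Fin (ν + 2)) :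
    (Fin ν → ℝ) →ₗ[ℝ] ℝ :=
  s⁻¹ • (∑ i : Fin (ν + 1) with i.castSucc < j,
    (branchSign ε i / κ i) • (extendForm i.succ - extendForm i.castSucc) -
      (c j + 1) • slopeForm ε κ)

/-- The derivative of `w ↦ G_w(x)` on the branch with index `i`. -/
def branchForm (ε : ℝ) (κ : Fin (ν + 1) → ℝ) (s : ℝ) (c : Fin (ν + 2) → ℝ) (i : Fin (ν + 1))
    (x : ℝ) : (Fin ν → ℝ) →ₗ[ℝ] ℝ :=
  extendForm i.castSucc + (branchSign ε i * κ i) •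
    ((x - c i.castSucc) • slopeForm ε κ - s • ptForm ε κ s c i.castSucc)

variable {ε : ℝ} {κ : Fin (ν + 1) → ℝ} {s : ℝ} {c : Fin (ν + 2) → ℝ} {g : ℝ → ℝ}

theorem ptForm_zero (h : c 0 = -1) : ptForm ε κ s c 0 = 0 := by
  rw [ptForm, filter_castSucc_lt_zero, h]; simp

/-- The factor `1/2` in `S` fixes the total length of the partition at `2`, so the last partition
point does not move. -/
theorem ptForm_last (h : c (Fin.last (ν + 1)) = 1) : ptForm ε κ s c (Fin.last (ν + 1)) = 0 := by
  rw [ptForm, filter_castSucc_lt_last, h, slopeForm, Finset.smul_sum, ← Finset.sum_sub_distrib]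
  rw [Finset.sum_eq_zero, smul_zero]
  intro i _
  rw [smul_smul, sub_eq_zero]
  congr 1
  ring

theorem branchForm_sub (i : Fin (ν + 1)) (x x' : ℝ) :
    branchForm ε κ s c i x' - branchForm ε κ s c i x =
      (branchSign ε i * κ i * (x' - x)) • slopeForm ε κ := by
  rw [branchForm, branchForm]; module

/-- This is the derivative of the identity saying that the branch with index `i` of `G_w` takes its
left partition point to the prescribed value; `branchForm_succ` is the same at the right partition
point. -/
theorem branchForm_castSucc (i : Fin (ν + 1)) :
    branchForm ε κ s c i (c i.castSucc) + branchSlope ε κ s i • ptForm ε κ s c i.castSucc =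
      extendForm i.castSucc := by
  rw [branchForm, branchSlope]; module

theorem branchForm_succ (hε : ε = 1 ∨ ε = -1) (hκ : ∀ i, 0 < κ i) (hs : 0 < s)
    (i : Fin (ν + 1)) :
    branchForm ε κ s c i (c i.succ) + branchSlope ε κ s i • ptForm ε κ s c i.succ =
      extendForm i.succ := by
  have h : s • ptForm ε κ s c i.succ = s • ptForm ε κ s c i.castSucc +
      (branchSign ε i / κ i) • (extendForm i.succ - extendForm i.castSucc) -
        (c i.succ - c i.castSucc) • slopeForm ε κ := by
    rw [ptForm, ptForm, smul_inv_smul₀ hs.ne', smul_inv_smul₀ hs.ne',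
      sum_filter_castSucc_lt_succ]
    module
  have h2 : (branchSign ε i * κ i) * (branchSign ε i / κ i) = 1 := by
    have := (hκ i).ne'
    field_simp
    rw [pow_two, branchSign_mul_self hε]
  rw [branchForm, branchSlope, mul_smul _ s, h, smul_sub _ (_ + _), smul_add _ (s • _), smul_smul _ (_ / _), h2]
  module

/-- The product of the first `n` slopes along the orbit of the `j`-th turning value. -/
def orbitMult (ε : ℝ) (κ : Fin (ν + 1) → ℝ) (s : ℝ) (c : Fin (ν + 2) → ℝ) (g : ℝ → ℝ)
    (j : Fin ν) (n : ℕ) : ℝ :=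
  ∏ k ∈ Finset.range n, branchSlope ε κ s (branchIdx c (g^[k + 1] (turn c j)))

/-- The normalized derivative of `w ↦ G_w^n(w_j)`, deformed by a parameter `t`. -/
def orbitForm (ε : ℝ) (κ : Fin (ν + 1) → ℝ) (s : ℝ) (c : Fin (ν + 2) → ℝ) (g : ℝ → ℝ)
    (t : ℝ) (j : Fin ν) (n : ℕ) : (Fin ν → ℝ) →ₗ[ℝ] ℝ :=
  LinearMap.proj j + ∑ k ∈ Finset.range n, (t ^ (k + 1) / orbitMult ε κ s c g j (k + 1)) •
    branchForm ε κ s c (branchIdx c (g^[k + 1] (turn c j))) (g^[k + 1] (turn c j))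

theorem orbitMult_ne_zero (hg : IsInClass ε κ s c g) (hε : ε = 1 ∨ ε = -1) (hκ : ∀ i, 0 < κ i)
    (j : Fin ν) (n : ℕ) : orbitMult ε κ s c g j n ≠ 0 :=
  Finset.prod_ne_zero_iff.2 fun _ _ => hg.branchSlope_ne_zero hε hκ _

theorem orbitMult_succ (j : Fin ν) (n : ℕ) : orbitMult ε κ s c g j (n + 1) =
    orbitMult ε κ s c g j n * branchSlope ε κ s (branchIdx c (g^[n + 1] (turn c j))) :=
  Finset.prod_range_succ _ _

theorem orbitForm_succ_apply (t : ℝ) (j : Fin ν) (n : ℕ) (w : Fin ν → ℝ) :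
    orbitForm ε κ s c g t j (n + 1) w = orbitForm ε κ s c g t j n w +
      t ^ (n + 1) / orbitMult ε κ s c g j (n + 1) *
        branchForm ε κ s c (branchIdx c (g^[n + 1] (turn c j))) (g^[n + 1] (turn c j)) w := by
  simp [orbitForm, Finset.sum_range_succ, add_assoc]

/-- The combinatorial properties of the integers `qⱼ`, `lⱼ`. -/
structure IsRelationTimes (g : ℝ → ℝ) (c : Fin (ν + 2) → ℝ) (j : Fin ν) (q l : ℕ) : Prop where
  one_le : 1 ≤ q
  ne_turn : ∀ k, 1 ≤ k → k < q → ∀ m, g^[k] (turn c j) ≠ turn c m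
  pre : (¬ ∃ m, g^[q] (turn c j) = turn c m) → 1 ≤ l ∧ l < q ∧
    g^[q] (turn c j) = g^[l] (turn c j)

open Classical in
/-- The normalized derivative of `Rⱼ`, deformed by a parameter `t`. -/
def relationForm (ε : ℝ) (κ : Fin (ν + 1) → ℝ) (s : ℝ) (c : Fin (ν + 2) → ℝ) (g : ℝ → ℝ)
    (q l : Fin ν → ℕ) (t : ℝ) (j : Fin ν) : (Fin ν → ℝ) →ₗ[ℝ] ℝ :=
  orbitForm ε κ s c g t j (q j - 1) -
    if h : ∃ m, g^[q j] (turn c j) = turn c m then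
      (t ^ q j / orbitMult ε κ s c g j (q j - 1)) • ptForm ε κ s c h.choose.succ.castSucc
    else (t ^ (q j - l j) * orbitMult ε κ s c g j (l j - 1) /
      orbitMult ε κ s c g j (q j - 1)) • orbitForm ε κ s c g t j (l j - 1)

/-! ### Kernel vectors as invariant vector fields. -/

section kernel

variable (ε κ s c g) in
/-- The action of `g`, deformed by the parameter `t`, on vector fields over the orbits. -/
def fieldMap (t : ℝ) (w : Fin ν → ℝ) (z : ℝ × ℝ) : ℝ × ℝ :=
  (g z.1, branchForm ε κ s c (branchIdx c z.1) z.1 w +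
    branchSlope ε κ s (branchIdx c z.1) * z.2 / t)

variable (ε κ s c) in
/-- The value of the vector field at a turning point. -/
def turnField (t : ℝ) (w : Fin ν → ℝ) (j : Fin ν) : ℝ × ℝ :=
  (turn c j, t * ptForm ε κ s c j.succ.castSucc w)

variable {t : ℝ} {w : Fin ν → ℝ}

/-- The factor `t` in `turnField` cancels the division by `t` in `fieldMap`, so the value at the
turning value is `w j` for every `t`. -/
theorem fieldMap_turnField (hg : IsInClass ε κ s c g) (ht : t ≠ 0) (j : Fin ν) :
    fieldMap ε κ s c g t w (turnField ε κ s c t w j) = (g (turn c j), w j) := by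
  have hb : branchIdx c (turn c j) = j.succ := by
    refine branchIdx_eq hg.strictMono le_rfl (Or.inl (hg.strictMono ?_))
    rw [Fin.lt_def]; simp
  have := LinearMap.congr_fun (branchForm_castSucc (ε := ε) (κ := κ) (s := s) (c := c) j.succ) w
  rw [extendForm_turn] at this
  simp only [fieldMap, turnField, hb, Prod.mk.injEq, true_and]
  simp only [LinearMap.add_apply, LinearMap.smul_apply, smul_eq_mul, LinearMap.proj_apply] at this
  rw [← this, turn]
  field_simp

/-- This explains the powers of `t` in `orbitForm`: clearing the denominators of the transported
field leaves an expression polynomial in `t`. -/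
theorem fieldMap_iterate_succ (hg : IsInClass ε κ s c g) (hε : ε = 1 ∨ ε = -1)
    (hκ : ∀ i, 0 < κ i) (ht : t ≠ 0) (j : Fin ν) (n : ℕ) :
    (fieldMap ε κ s c g t w)^[n + 1] (turnField ε κ s c t w j) =
      (g^[n + 1] (turn c j),
        orbitMult ε κ s c g j n / t ^ n * orbitForm ε κ s c g t j n w) := by
  induction n with
  | zero =>
    simp [fieldMap_turnField hg ht, orbitMult, orbitForm]
  | succ n ih =>
    rw [Function.iterate_succ_apply', ih, fieldMap, ← Function.iterate_succ_apply' g (n + 1)]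
    simp only [Prod.mk.injEq, true_and]
    have h1 := orbitMult_ne_zero hg hε hκ j (n + 1)
    rw [orbitForm_succ_apply, mul_add]
    have h4 : orbitMult ε κ s c g j (n + 1) / t ^ (n + 1) *
        (t ^ (n + 1) / orbitMult ε κ s c g j (n + 1) *
          branchForm ε κ s c (branchIdx c (g^[n + 1] (turn c j))) (g^[n + 1] (turn c j)) w) =
        branchForm ε κ s c (branchIdx c (g^[n + 1] (turn c j))) (g^[n + 1] (turn c j)) w := by
      field_simp
    rw [h4, orbitMult_succ]
    field_simp
    ring

/-- `fieldMap` uses the right branch at a turning point, but the left branch gives the same result,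
because both adjacent branches of `G_w` send the moving turning point to the same `w_j`. Hence
chords may be treated within closed branches. -/
theorem fieldMap_snd_of_mem (hg : IsInClass ε κ s c g) (hε : ε = 1 ∨ ε = -1)
    (hκ : ∀ i, 0 < κ i) (ht : t ≠ 0) {i : Fin (ν + 1)} {z : ℝ × ℝ}
    (hz : z.1 ∈ Icc (c i.castSucc) (c i.succ))
    (hturn : ∀ j, z.1 = turn c j → z = turnField ε κ s c t w j) :
    (fieldMap ε κ s c g t w z).2 = branchForm ε κ s c i z.1 w + branchSlope ε κ s i * z.2 / t := by
  rcases hz.2.lt_or_eq with h | h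
  · rw [fieldMap, branchIdx_eq hg.strictMono hz.1 (Or.inl h)]
  · induction i using Fin.lastCases with
    | last => rw [fieldMap, branchIdx_eq hg.strictMono hz.1 (Or.inr rfl)]
    | cast j =>
      rw [← Fin.castSucc_succ] at h
      rw [hturn j h, fieldMap_turnField hg ht]
      have := LinearMap.congr_fun (branchForm_succ (c := c) hε hκ hg.s_pos j.castSucc) w
      rw [← Fin.castSucc_succ, extendForm_turn] at this
      simp only [LinearMap.add_apply, LinearMap.smul_apply, smul_eq_mul,
        LinearMap.proj_apply] at this
      simp only [turnField]
      rw [← this, turn]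
      field_simp

variable {q l : Fin ν → ℕ}

/-- The `j`-th relation is the closing condition: at time `q j` the transported pair returns either
to a starting pair `turnField` or to the earlier pair at time `l j`. -/
theorem fieldMap_iterate_of_relation (hg : IsInClass ε κ s c g) (hε : ε = 1 ∨ ε = -1)
    (hκ : ∀ i, 0 < κ i) (ht : t ≠ 0) (hqs : ∀ j, IsRelationTimes g c j (q j) (l j)) {j : Fin ν}
    (hw : relationForm ε κ s c g q l t j w = 0) :
    ∃ m, ∃ k < q m, (fieldMap ε κ s c g t w)^[q j] (turnField ε κ s c t w j) =
      (fieldMap ε κ s c g t w)^[k] (turnField ε κ s c t w m) := by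
  have hq := hqs j
  have hq1 : q j - 1 + 1 = q j := Nat.sub_add_cancel hq.one_le
  have hit := fieldMap_iterate_succ (w := w) hg hε hκ ht j (q j - 1)
  rw [hq1] at hit
  have hD := orbitMult_ne_zero hg hε hκ j (q j - 1)
  rw [relationForm] at hw
  split_ifs at hw with h
  · rw [LinearMap.sub_apply, sub_eq_zero, LinearMap.smul_apply, smul_eq_mul] at hw
    refine ⟨h.choose, 0, (hqs _).one_le, ?_⟩
    rw [hit, Function.iterate_zero_apply, turnField, ← h.choose_spec, Prod.mk.injEq]
    refine ⟨rfl, ?_⟩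
    rw [hw]
    have : t ^ q j = t ^ (q j - 1) * t := by rw [← pow_succ, hq1]
    rw [this]
    field_simp
  · obtain ⟨h1, h2, h3⟩ := hq.pre h
    refine ⟨j, l j, h2, ?_⟩
    have hit' := fieldMap_iterate_succ (w := w) hg hε hκ ht j (l j - 1)
    rw [Nat.sub_add_cancel h1] at hit'
    rw [hit, hit', h3, Prod.mk.injEq]
    refine ⟨rfl, ?_⟩
    rw [LinearMap.sub_apply, sub_eq_zero, LinearMap.smul_apply, smul_eq_mul] at hw
    rw [hw]
    have : t ^ (q j - 1) = t ^ (q j - l j) * t ^ (l j - 1) := by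
      rw [← pow_add]; congr 1; omega
    rw [this]
    field_simp

variable (ε κ s c g) in
/-- The vector field over the orbits of the turning points and the endpoints. -/
def orbitField (q : Fin ν → ℕ) (t : ℝ) (w : Fin ν → ℝ) : Finset (ℝ × ℝ) :=
  {(-1, 0), (1, 0)} ∪ Finset.univ.biUnion fun j => (Finset.range (q j)).image fun k =>
    (fieldMap ε κ s c g t w)^[k] (turnField ε κ s c t w j)

theorem mem_orbitField {z : ℝ × ℝ} : z ∈ orbitField ε κ s c g q t w ↔
    (z = (-1, 0) ∨ z = (1, 0)) ∨
      ∃ j, ∃ k < q j, (fieldMap ε κ s c g t w)^[k] (turnField ε κ s c t w j) = z := by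
  simp [orbitField, or_assoc]

theorem fieldMap_fst_iterate (z : ℝ × ℝ) (n : ℕ) :
    ((fieldMap ε κ s c g t w)^[n] z).1 = g^[n] z.1 := by
  induction n with
  | zero => rfl
  | succ n ih => rw [Function.iterate_succ_apply', Function.iterate_succ_apply', fieldMap, ih]

/-- Orbits are cut at their first return to the turning points, so the field is single-valued there.
Over other points it may be multivalued at this stage. -/
theorem eq_turnField_of_mem (hg : IsInClass ε κ s c g)
    (hqs : ∀ j, IsRelationTimes g c j (q j) (l j)) {z : ℝ × ℝ}
    (hz : z ∈ orbitField ε κ s c g q t w)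
    {m : Fin ν} (hm : z.1 = turn c m) : z = turnField ε κ s c t w m := by
  have hm' := hg.turn_mem_Ioo m
  rw [← hm] at hm'
  rcases mem_orbitField.1 hz with (rfl | rfl) | ⟨j, k, hk, rfl⟩
  · exact absurd hm'.1 (lt_irrefl _)
  · exact absurd hm'.2 (lt_irrefl _)
  · rw [fieldMap_fst_iterate] at hm
    rcases Nat.eq_zero_or_pos k with rfl | hk0
    · rw [hg.turn_strictMono.injective hm]
      rfl
    · exact absurd hm ((hqs j).ne_turn k hk0 hk m)

section
variable (hg : IsInClass ε κ s c g) (hε : ε = 1 ∨ ε = -1) (hκ : ∀ i, 0 < κ i) (ht : t ≠ 0)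
  (hqs : ∀ j, IsRelationTimes g c j (q j) (l j))
include hg hε hκ ht hqs

theorem fieldMap_mem (hw : ∀ j, relationForm ε κ s c g q l t j w = 0) {z : ℝ × ℝ}
    (hz : z ∈ orbitField ε κ s c g q t w) :
    fieldMap ε κ s c g t w z ∈ orbitField ε κ s c g q t w := by
  have hb₁ : branchIdx c (1 : ℝ) = Fin.last ν := branchIdx_eq hg.strictMono
    (by rw [← hg.c_last]; exact hg.strictMono.monotone (Fin.le_last _)) (Or.inr rfl)
  have hb₀ : branchIdx c (-1 : ℝ) = 0 := branchIdx_eq hg.strictMono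
    (by rw [Fin.castSucc_zero, hg.c_zero])
    (Or.inl (by rw [← hg.c_zero]; exact hg.strictMono (Fin.succ_pos _)))
  have hsign : ∀ i : Fin (ν + 1), branchSign ε i = 1 ∨ branchSign ε i = -1 := fun i =>
    mul_self_eq_one_iff.1 (branchSign_mul_self hε i)
  rw [mem_orbitField]
  rcases mem_orbitField.1 hz with (rfl | rfl) | ⟨j, k, hk, rfl⟩
  -- Endpoints go to endpoints, and the value stays `0` because both the endpoint and its image are
  -- fixed in the family.
  · left
    have h : (fieldMap ε κ s c g t w (-1, 0)).2 = 0 := by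
      have := LinearMap.congr_fun (branchForm_castSucc (ε := ε) (κ := κ) (s := s) (c := c) 0) w
      rw [Fin.castSucc_zero, hg.c_zero, ptForm_zero hg.c_zero, extendForm_zero] at this
      simpa [fieldMap, hb₀] using this
    have h' : (fieldMap ε κ s c g t w (-1, 0)).1 = -branchSign ε (0 : Fin (ν + 1)) := hg.left_end
    rcases hsign 0 with e | e
    · left; ext <;> simp [h, h', e]
    · right; ext <;> simp [h, h', e]
  · left
    have h : (fieldMap ε κ s c g t w (1, 0)).2 = 0 := by
      have := LinearMap.congr_fun (branchForm_succ (c := c) hε hκ hg.s_pos (Fin.last ν)) w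
      rw [Fin.succ_last, hg.c_last, ptForm_last hg.c_last, extendForm_last] at this
      simpa [fieldMap, hb₁] using this
    have h' : (fieldMap ε κ s c g t w (1, 0)).1 = branchSign ε (Fin.last ν) := hg.right_end
    rcases hsign (Fin.last ν) with e | e
    · right; ext <;> simp [h, h', e]
    · left; ext <;> simp [h, h', e]
  · right
    rw [← Function.iterate_succ_apply' (fieldMap ε κ s c g t w)]
    rcases Nat.lt_or_ge (k + 1) (q j) with h | h
    · exact ⟨j, k + 1, h, rfl⟩
    · obtain ⟨m, k', hk', h'⟩ := fieldMap_iterate_of_relation hg hε hκ ht hqs (hw j)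
      rw [show k.succ = q j by omega]
      exact ⟨m, k', hk', h'.symm⟩

theorem slopeSystem_orbitField (hw : ∀ j, relationForm ε κ s c g q l t j w = 0)
    (hIcc : ∀ j n, g^[n] (turn c j) ∈ Icc (-1 : ℝ) 1) :
    SlopeSystem g c (branchSlope ε κ s) t (slopeForm ε κ w / s)
      (orbitField ε κ s c g q t w) where
  left_mem := mem_orbitField.2 (Or.inl (Or.inl rfl))
  right_mem := mem_orbitField.2 (Or.inl (Or.inr rfl))
  fst_mem z hz := by
    rcases mem_orbitField.1 hz with (rfl | rfl) | ⟨j, k, hk, rfl⟩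
    · norm_num
    · norm_num
    · rw [fieldMap_fst_iterate]
      exact hIcc j k
  turn_mem i := by
    rcases hg.eq_ends_or_turn i with h | h | ⟨j, rfl⟩
    · exact ⟨_, mem_orbitField.2 (Or.inl (Or.inl rfl)), h.symm⟩
    · exact ⟨_, mem_orbitField.2 (Or.inl (Or.inr rfl)), h.symm⟩
    · exact ⟨_, mem_orbitField.2 (Or.inr ⟨j, 0, (hqs j).one_le, rfl⟩), rfl⟩
  image i z hz z' hz' h h' := by
    refine ⟨_, fieldMap_mem hg hε hκ ht hqs hw hz, _, fieldMap_mem hg hε hκ ht hqs hw hz',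
      rfl, rfl, ?_⟩
    rw [fieldMap_snd_of_mem hg hε hκ ht h fun j hj => eq_turnField_of_mem hg hqs hz hj,
      fieldMap_snd_of_mem hg hε hκ ht h' fun j hj => eq_turnField_of_mem hg hqs hz' hj]
    have := LinearMap.congr_fun (branchForm_sub (ε := ε) (κ := κ) (s := s) (c := c) i z.1 z'.1) w
    simp only [LinearMap.sub_apply, LinearMap.smul_apply, smul_eq_mul] at this
    have hs := hg.s_pos.ne'
    rw [← sub_eq_zero] at this ⊢
    rw [← this, branchSlope]
    field_simp
    ring

end

/-- Absence of kernel for the deformed normalized derivative of the relation map. -/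
theorem eq_zero_of_relationForm_eq_zero (hg : IsInClass ε κ s c g) (hε : ε = 1 ∨ ε = -1)
    (hκ : ∀ i, 0 < κ i) (herg : IsErgodic g) (ht : 0 < t) (ht' : t ≤ 1)
    (hqs : ∀ j, IsRelationTimes g c j (q j) (l j))
    (hIcc : ∀ j n, g^[n] (turn c j) ∈ Icc (-1 : ℝ) 1)
    (hw : ∀ j, relationForm ε κ s c g q l t j w = 0) : w = 0 := by
  have hT := slopeSystem_orbitField hg hε hκ ht.ne' hqs hw hIcc
  funext j
  have hmem : turnField ε κ s c t w j ∈ orbitField ε κ s c g q t w :=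
    mem_orbitField.2 (Or.inr ⟨j, 0, (hqs j).one_le, rfl⟩)
  -- The field is read off at the turning value, where it equals `w j`, rather than at the turning
  -- point.
  have := hT.snd_eq_zero hg hε hκ herg ht ht' (fieldMap_mem hg hε hκ ht.ne' hqs hw hmem)
  rwa [fieldMap_turnField hg ht.ne'] at this

end kernel

/-! ### The homotopy in `t` and the sign of the determinant. -/

theorem continuous_orbitForm (j : Fin ν) (n : ℕ) (w : Fin ν → ℝ) :
    Continuous fun t => orbitForm ε κ s c g t j n w := by
  simp only [orbitForm, LinearMap.add_apply, LinearMap.sum_apply, LinearMap.smul_apply]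
  fun_prop

theorem continuous_relationForm (q l : Fin ν → ℕ) (j : Fin ν) (w : Fin ν → ℝ) :
    Continuous fun t => relationForm ε κ s c g q l t j w := by
  unfold relationForm
  split_ifs with h
  · simp only [LinearMap.sub_apply, LinearMap.smul_apply]
    have := continuous_orbitForm (ε := ε) (κ := κ) (s := s) (c := c) (g := g) j (q j - 1) w
    fun_prop
  · simp only [LinearMap.sub_apply, LinearMap.smul_apply]
    have := continuous_orbitForm (ε := ε) (κ := κ) (s := s) (c := c) (g := g) j (q j - 1) w
    have := continuous_orbitForm (ε := ε) (κ := κ) (s := s) (c := c) (g := g) j (l j - 1) w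
    fun_prop

theorem orbitForm_param_zero (j : Fin ν) (n : ℕ) :
    orbitForm ε κ s c g 0 j n = LinearMap.proj j := by
  simp [orbitForm]

/-- The subtracted terms carry `t ^ q j` or `t ^ (q j - l j)`; both exponents are positive. -/
theorem relationForm_param_zero {q l : Fin ν → ℕ}
    (hqs : ∀ j, IsRelationTimes g c j (q j) (l j)) (j : Fin ν) :
    relationForm ε κ s c g q l 0 j = LinearMap.proj j := by
  rw [relationForm, orbitForm_param_zero]
  split_ifs with h
  · have := (hqs j).one_le
    rw [zero_pow (by omega)]; simp
  · have := ((hqs j).pre h).2.1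
    rw [zero_pow (by omega)]; simp

theorem det_relationForm_pos (hg : IsInClass ε κ s c g) (hε : ε = 1 ∨ ε = -1)
    (hκ : ∀ i, 0 < κ i) (herg : IsErgodic g) {q l : Fin ν → ℕ}
    (hqs : ∀ j, IsRelationTimes g c j (q j) (l j))
    (hIcc : ∀ j n, g^[n] (turn c j) ∈ Icc (-1 : ℝ) 1) :
    0 < (Matrix.of fun j k => relationForm ε κ s c g q l 1 j (Pi.single k 1)).det := by
  set A : ℝ → Matrix (Fin ν) (Fin ν) ℝ := fun t =>
    Matrix.of fun j k => relationForm ε κ s c g q l t j (Pi.single k 1) with hA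
  have hmul : ∀ t w j, (A t).mulVec w j = relationForm ε κ s c g q l t j w := by
    intro t w j
    conv_rhs => rw [pi_eq_sum_univ' w]
    simp [Matrix.mulVec, dotProduct, hA, mul_comm, map_sum]
  have hcont : Continuous fun t => (A t).det :=
    (continuous_matrix fun j k => continuous_relationForm q l j _).matrix_det
  have h0 : (A 0).det = 1 := by
    have : A 0 = 1 := by
      ext j k
      simp [hA, relationForm_param_zero hqs, Matrix.one_apply, Pi.single_apply]
    rw [this, Matrix.det_one]
  have hne : ∀ t ∈ Icc (0 : ℝ) 1, (A t).det ≠ 0 := by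
    intro t ht hdet
    rcases ht.1.eq_or_lt with rfl | hpos
    · rw [h0] at hdet; exact one_ne_zero hdet
    obtain ⟨w, hw, hAw⟩ := Matrix.exists_mulVec_eq_zero_iff.2 hdet
    refine hw (eq_zero_of_relationForm_eq_zero hg hε hκ herg hpos ht.2 hqs hIcc fun j => ?_)
    rw [← hmul, hAw]; rfl
  by_contra hneg
  obtain ⟨t, ht, h⟩ := intermediate_value_Icc' (zero_le_one (α := ℝ)) hcont.continuousOn
    ⟨not_lt.1 hneg, by rw [h0]; exact zero_le_one⟩
  exact hne t ht h

end

/-! ### Symmetry, holomorphy and derivatives of the family. -/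

section

variable {ν : ℕ} {ε : ℝ} {κ : Fin (ν + 1) → ℝ} {s : ℝ} {c : Fin (ν + 2) → ℝ} {g : ℝ → ℝ}

theorem extend_zero (w : Fin ν → ℂ) : extend ε w 0 = -(branchSign ε (0 : Fin (ν + 1)) : ℂ) := rfl

theorem extend_last (w : Fin ν → ℂ) :
    extend ε w (Fin.last (ν + 1)) = (branchSign ε (Fin.last ν) : ℂ) := by
  rw [← Fin.succ_last, extend, Fin.cons_succ, Fin.snoc_last]

theorem extend_turn (w : Fin ν → ℂ) (j : Fin ν) : extend ε w j.succ.castSucc = w j := by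
  rw [Fin.castSucc_succ, extend, Fin.cons_succ, Fin.snoc_castSucc]

theorem forall_fin_ends_turn {p : Fin (ν + 2) → Prop} (h0 : p 0) (h1 : p (Fin.last (ν + 1)))
    (h : ∀ j : Fin ν, p j.succ.castSucc) (i : Fin (ν + 2)) : p i := by
  induction i using Fin.cases with
  | zero => exact h0
  | succ i =>
    induction i using Fin.lastCases with
    | last => rw [Fin.succ_last]; exact h1
    | cast i => rw [← Fin.castSucc_succ]; exact h i

/-- The complex line through the vector of turning values in the real direction `w`. -/
def critLine (g : ℝ → ℝ) (c : Fin (ν + 2) → ℝ) (w : Fin ν → ℝ) (τ : ℂ) (j : Fin ν) : ℂ :=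
  (g (turn c j) : ℂ) + τ * (w j : ℂ)

theorem extend_critLine (hg : IsInClass ε κ s c g) (w : Fin ν → ℝ) (τ : ℂ) (i : Fin (ν + 2)) :
    extend ε (critLine g c w τ) i = (g (c i) : ℂ) + τ * (extendForm i w : ℝ) := by
  induction i using forall_fin_ends_turn with
  | h0 => simp [extend_zero, extendForm_zero, hg.c_zero, hg.left_end]
  | h1 => simp [extend_last, extendForm_last, hg.c_last, hg.right_end]
  | h j => rw [extend_turn, extendForm_turn]; rfl

theorem map_step (hg : IsInClass ε κ s c g) (hε : ε = 1 ∨ ε = -1) (hκ : ∀ i, 0 < κ i)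
    (i : Fin (ν + 1)) :
    (g (c i.succ) - g (c i.castSucc)) * branchSign ε i / κ i = s * (c i.succ - c i.castSucc) := by
  have hle : c i.castSucc ≤ c i.succ := (hg.strictMono Fin.castSucc_lt_succ).le
  have := (hκ i).ne'
  rw [hg.map_sub i (right_mem_Icc.2 hle) (left_mem_Icc.2 hle), branchSlope]
  field_simp
  linear_combination (s * (c i.succ - c i.castSucc)) * branchSign_mul_self hε i

/-- `S` is affine in `w`. Its value at the turning values is `s`, since by `map_step` the summands
are `s` times half the branch lengths, whose total is `2`. -/
theorem slope_critLine (hg : IsInClass ε κ s c g) (hε : ε = 1 ∨ ε = -1) (hκ : ∀ i, 0 < κ i)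
    (w : Fin ν → ℝ) (τ : ℂ) :
    slope ε κ (critLine g c w τ) = s + τ * (slopeForm ε κ w : ℝ) := by
  have h1 : (s : ℂ) = ((∑ i : Fin (ν + 1), s * (c i.succ - c i.castSucc) / 2 : ℝ) : ℂ) := by
    have := sum_filter_castSucc_sub c (Fin.last (ν + 1))
    rw [filter_castSucc_lt_last, hg.c_zero, hg.c_last] at this
    rw [← Finset.sum_div, ← Finset.mul_sum, this]
    push_cast; ring
  rw [h1, slope, slopeForm, LinearMap.sum_apply]
  push_cast
  rw [Finset.mul_sum, ← Finset.sum_add_distrib]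
  refine Finset.sum_congr rfl fun i _ => ?_
  have h2 := congrArg (fun x : ℝ => (x : ℂ)) (map_step hg hε hκ i)
  push_cast at h2
  rw [← h2, extend_critLine hg, extend_critLine hg]
  have : (κ i : ℂ) ≠ 0 := by exact_mod_cast (hκ i).ne'
  simp only [LinearMap.smul_apply, LinearMap.sub_apply, smul_eq_mul]
  push_cast
  field_simp
  ring

theorem hasDerivAt_partitionPt_critLine (hg : IsInClass ε κ s c g) (hε : ε = 1 ∨ ε = -1)
    (hκ : ∀ i, 0 < κ i) (w : Fin ν → ℝ) (j : Fin (ν + 2)) :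
    HasDerivAt (fun τ => partitionPt ε κ (critLine g c w τ) j) (ptForm ε κ s c j w : ℝ) 0 := by
  have hs : (s : ℂ) ≠ 0 := by exact_mod_cast hg.s_pos.ne'
  have hslope : HasDerivAt (fun τ => slope ε κ (critLine g c w τ)) (slopeForm ε κ w : ℝ) 0 := by
    simp only [slope_critLine hg hε hκ]
    simpa using ((hasDerivAt_id (0 : ℂ)).mul_const ((slopeForm ε κ w : ℝ) : ℂ)).const_add (s : ℂ)
  have hs0 : slope ε κ (critLine g c w 0) = s := by rw [slope_critLine hg hε hκ]; simp
  have hext : ∀ i, HasDerivAt (fun τ => extend ε (critLine g c w τ) i) (extendForm i w : ℝ) 0 := by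
    intro i
    simp only [extend_critLine hg]
    simpa using ((hasDerivAt_id (0 : ℂ)).mul_const ((extendForm i w : ℝ) : ℂ)).const_add
      (g (c i) : ℂ)
  have hext0 : ∀ i, extend ε (critLine g c w 0) i = g (c i) := by
    intro i; rw [extend_critLine hg]; simp
  have := (HasDerivAt.fun_sum (u := Finset.univ.filter fun i : Fin (ν + 1) => i.castSucc < j)
    fun i _ => ((((hext i.succ).sub (hext i.castSucc)).mul_const (branchSign ε i : ℂ)).div_const
      (κ i : ℂ)).div hslope (by rw [hs0]; exact hs)).const_add (-1)
  refine this.congr_deriv ?_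
  have hc := sum_filter_castSucc_sub c j
  rw [hg.c_zero, sub_neg_eq_add] at hc
  rw [ptForm, ← hc, Finset.sum_smul, ← Finset.sum_sub_distrib, Finset.smul_sum, LinearMap.sum_apply,
    Complex.ofReal_sum]
  refine Finset.sum_congr rfl fun i _ => ?_
  have h2 := congrArg (fun x : ℝ => (x : ℂ)) (map_step hg hε hκ i)
  push_cast at h2
  simp only [Pi.sub_apply, hs0, hext0]
  rw [h2]
  have : (κ i : ℂ) ≠ 0 := by exact_mod_cast (hκ i).ne'
  simp only [LinearMap.smul_apply, LinearMap.sub_apply, smul_eq_mul]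
  push_cast
  field_simp

theorem partitionPt_critLine_zero (hg : IsInClass ε κ s c g) (hε : ε = 1 ∨ ε = -1)
    (hκ : ∀ i, 0 < κ i) (w : Fin ν → ℝ) (j : Fin (ν + 2)) :
    partitionPt ε κ (critLine g c w 0) j = c j := by
  have hs : (s : ℂ) ≠ 0 := by exact_mod_cast hg.s_pos.ne'
  have hc := sum_filter_castSucc_sub c j
  rw [hg.c_zero, sub_neg_eq_add] at hc
  have : (c j : ℂ) = -1 + ((c j + 1 : ℝ) : ℂ) := by push_cast; ring
  rw [this, ← hc, partitionPt, Complex.ofReal_sum]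
  congr 1
  refine Finset.sum_congr rfl fun i _ => ?_
  have h2 := congrArg (fun x : ℝ => (x : ℂ)) (map_step hg hε hκ i)
  push_cast at h2
  rw [slope_critLine hg hε hκ, extend_critLine hg, extend_critLine hg]
  simp only [zero_mul, add_zero]
  rw [h2]
  push_cast
  field_simp

theorem critVal_eq (hg : IsInClass ε κ s c g) (w : Fin ν → ℝ) :
    MarkedMap.critVal (complexMap ε κ s c g) (turnC c) = critLine g c w 0 := by
  funext j
  rw [MarkedMap.critVal, turnC, hg.complexMap_ofReal (Ioo_subset_Icc_self (hg.turn_mem_Ioo j))]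
  simp [critLine]

theorem family_critVal (hg : IsInClass ε κ s c g) (hε : ε = 1 ∨ ε = -1) (hκ : ∀ i, 0 < κ i)
    (z : ℂ) : family ε κ c (MarkedMap.critVal (complexMap ε κ s c g) (turnC c)) z =
      complexMap ε κ s c g z := by
  rw [critVal_eq hg 0, family, complexMap, partitionPt_critLine_zero hg hε hκ,
    slope_critLine hg hε hκ, extend_critLine hg]
  push_cast
  ring

theorem turnMap_critVal (hg : IsInClass ε κ s c g) (hε : ε = 1 ∨ ε = -1) (hκ : ∀ i, 0 < κ i) :
    turnMap ε κ (MarkedMap.critVal (complexMap ε κ s c g) (turnC c)) = turnC c := by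
  funext j
  rw [critVal_eq hg 0, turnMap, partitionPt_critLine_zero hg hε hκ]; rfl

theorem extend_conj (w : Fin ν → ℂ) (i : Fin (ν + 2)) :
    extend ε (fun j => (starRingEnd ℂ) (w j)) i = (starRingEnd ℂ) (extend ε w i) := by
  induction i using forall_fin_ends_turn with
  | h0 => simp [extend_zero]
  | h1 => simp [extend_last]
  | h j => rw [extend_turn, extend_turn]

theorem slope_conj (w : Fin ν → ℂ) :
    slope ε κ (fun j => (starRingEnd ℂ) (w j)) = (starRingEnd ℂ) (slope ε κ w) := by
  simp [slope, extend_conj, map_sum, Complex.conj_ofNat]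

theorem partitionPt_conj (w : Fin ν → ℂ) (j : Fin (ν + 2)) :
    partitionPt ε κ (fun j => (starRingEnd ℂ) (w j)) j = (starRingEnd ℂ) (partitionPt ε κ w j) := by
  simp [partitionPt, extend_conj, slope_conj, map_sum]

theorem family_conj (w : Fin ν → ℂ) (z : ℂ) :
    family ε κ c (fun j => (starRingEnd ℂ) (w j)) ((starRingEnd ℂ) z) =
      (starRingEnd ℂ) (family ε κ c w z) := by
  simp [family, extend_conj, slope_conj, partitionPt_conj]

theorem complexMap_conj (z : ℂ) :
    complexMap ε κ s c g ((starRingEnd ℂ) z) = (starRingEnd ℂ) (complexMap ε κ s c g z) := by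
  simp [complexMap]

theorem differentiable_extend (i : Fin (ν + 2)) :
    Differentiable ℂ fun w : Fin ν → ℂ => extend ε w i := by
  induction i using forall_fin_ends_turn with
  | h0 => simp only [extend_zero]; fun_prop
  | h1 => simp only [extend_last]; fun_prop
  | h j => simp only [extend_turn]; fun_prop

theorem differentiable_slope : Differentiable ℂ fun w : Fin ν → ℂ => slope ε κ w := by
  have := differentiable_extend (ν := ν) (ε := ε)
  unfold slope
  fun_prop

theorem differentiableAt_partitionPt {w : Fin ν → ℂ} (hw : slope ε κ w ≠ 0) (j : Fin (ν + 2)) :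
    DifferentiableAt ℂ (fun w : Fin ν → ℂ => partitionPt ε κ w j) w := by
  have := differentiable_extend (ν := ν) (ε := ε)
  have := differentiable_slope (ε := ε) (κ := κ)
  unfold partitionPt
  refine (differentiableAt_const _).add (DifferentiableAt.fun_sum fun i _ => ?_)
  fun_prop (disch := exact hw)

theorem branchIdx_eq_of_abs_lt (hc : StrictMono c) {x y ρ : ℝ} (h₀ : c 0 ≤ x)
    (h : ∀ j, ρ ≤ |x - turn c j|) (hy : |y - x| < ρ) : branchIdx c y = branchIdx c x := by
  refine branchIdx_eq_of_forall fun j => ?_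
  obtain ⟨h1, h2⟩ := branchIdx_spec hc h₀
  rw [← turn_le_iff hc h1 h2]
  have := h j
  rw [abs_lt] at hy
  rcases le_abs.1 this with h' | h'
  · constructor <;> intro <;> linarith
  · constructor <;> intro <;> linarith

theorem eventually_branchIdx_re_eq (hc : StrictMono c) {x : ℝ} (h₀ : c 0 ≤ x)
    (h : ∀ j, x ≠ turn c j) : ∀ᶠ z : ℂ in nhds (x : ℂ), branchIdx c z.re = branchIdx c x := by
  have hρ : ∃ ρ > 0, ∀ j, ρ ≤ |x - turn c j| := by
    rcases isEmpty_or_nonempty (Fin ν) with he | he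
    · exact ⟨1, one_pos, fun j => he.elim j⟩
    · obtain ⟨j, hj⟩ := Finite.exists_min fun j => |x - turn c j|
      exact ⟨_, abs_pos.2 (sub_ne_zero.2 (h j)), hj⟩
  obtain ⟨ρ, hρ0, hρ⟩ := hρ
  filter_upwards [Metric.ball_mem_nhds (x : ℂ) hρ0] with z hz
  refine branchIdx_eq_of_abs_lt hc h₀ hρ ?_
  rw [mem_ball_iff_norm] at hz
  have := Complex.abs_re_le_norm (z - x)
  simp only [Complex.sub_re, Complex.ofReal_re] at this
  linarith

theorem hasDerivAt_complexMap (hg : IsInClass ε κ s c g) {x : ℝ} (hx : x ∈ Icc (-1 : ℝ) 1)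
    (h : ∀ j, x ≠ turn c j) :
    HasDerivAt (complexMap ε κ s c g) (branchSlope ε κ s (branchIdx c x) : ℂ) x := by
  have h1 : HasDerivAt (fun z : ℂ => (g (c (branchIdx c x).castSucc) : ℂ) +
      (branchSlope ε κ s (branchIdx c x) : ℂ) * (z - (c (branchIdx c x).castSucc : ℂ)))
      (branchSlope ε κ s (branchIdx c x) : ℂ) x := by
    simpa using (((hasDerivAt_id (x : ℂ)).sub_const (c (branchIdx c x).castSucc : ℂ)).const_mul
      (branchSlope ε κ s (branchIdx c x) : ℂ)).const_add (g (c (branchIdx c x).castSucc) : ℂ)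
  refine h1.congr_of_eventuallyEq ?_
  filter_upwards [eventually_branchIdx_re_eq hg.strictMono (by rw [hg.c_zero]; exact hx.1) h]
    with z hz
  rw [complexMap, hz, branchSlope]

theorem differentiableAt_family {w : Fin ν → ℂ} (hw : slope ε κ w ≠ 0) {z : ℂ}
    (hz : ∀ᶠ y in nhds z, branchIdx c y.re = branchIdx c z.re) :
    DifferentiableAt ℂ (fun a : (Fin ν → ℂ) × ℂ => family ε κ c a.1 a.2) (w, z) := by
  have h1 : DifferentiableAt ℂ (fun a : (Fin ν → ℂ) × ℂ =>
      extend ε a.1 (branchIdx c z.re).castSucc) (w, z) :=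
    (differentiable_extend _).comp differentiable_fst (w, z)
  have h2 : DifferentiableAt ℂ (fun a : (Fin ν → ℂ) × ℂ => slope ε κ a.1) (w, z) :=
    differentiable_slope.comp differentiable_fst (w, z)
  have h3 : DifferentiableAt ℂ (fun a : (Fin ν → ℂ) × ℂ =>
      partitionPt ε κ a.1 (branchIdx c z.re).castSucc) (w, z) :=
    (differentiableAt_partitionPt (w := (w, z).1) hw _).comp (w, z) differentiableAt_fst
  have h4 : DifferentiableAt ℂ (fun a : (Fin ν → ℂ) × ℂ =>
      extend ε a.1 (branchIdx c z.re).castSucc + (κ (branchIdx c z.re) : ℂ) *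
        (branchSign ε (branchIdx c z.re) : ℂ) * slope ε κ a.1 *
          (a.2 - partitionPt ε κ a.1 (branchIdx c z.re).castSucc)) (w, z) := by
    fun_prop
  refine h4.congr_of_eventuallyEq ?_
  filter_upwards [(continuousAt_snd (p := (w, z))).eventually hz] with a ha
  rw [family, ha]

/-- One step of the chain rule along the orbit. Away from turning points the branch index is locally
constant, so `family` may be replaced by a single affine formula. -/
theorem hasDerivAt_family_critLine (hg : IsInClass ε κ s c g) (hε : ε = 1 ∨ ε = -1)
    (hκ : ∀ i, 0 < κ i) (w : Fin ν → ℝ) {z : ℂ → ℂ} {x v : ℝ} (hx : x ∈ Icc (-1 : ℝ) 1)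
    (h : ∀ j, x ≠ turn c j) (hz : HasDerivAt z v 0) (hz0 : z 0 = x) :
    HasDerivAt (fun τ => family ε κ c (critLine g c w τ) (z τ))
      ((branchForm ε κ s c (branchIdx c x) x w + branchSlope ε κ s (branchIdx c x) * v : ℝ) : ℂ)
      0 := by
  set i := branchIdx c x with hi
  have h1 : HasDerivAt (fun τ => extend ε (critLine g c w τ) i.castSucc +
      (κ i : ℂ) * (branchSign ε i : ℂ) * slope ε κ (critLine g c w τ) *
        (z τ - partitionPt ε κ (critLine g c w τ) i.castSucc))
      ((branchForm ε κ s c i x w + branchSlope ε κ s i * v : ℝ) : ℂ) 0 := by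
    simp only [extend_critLine hg, slope_critLine hg hε hκ]
    have e1 := ((hasDerivAt_id (0 : ℂ)).mul_const ((extendForm i.castSucc w : ℝ) : ℂ)).const_add
      (g (c i.castSucc) : ℂ)
    have e2 := (((hasDerivAt_id (0 : ℂ)).mul_const ((slopeForm ε κ w : ℝ) : ℂ)).const_add
      (s : ℂ)).const_mul ((κ i : ℂ) * (branchSign ε i : ℂ))
    have e3 := hz.sub (hasDerivAt_partitionPt_critLine hg hε hκ w i.castSucc)
    refine (e1.add (e2.mul e3)).congr_deriv ?_
    simp only [id, Pi.sub_apply, hz0, partitionPt_critLine_zero hg hε hκ, branchForm, branchSlope,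
      LinearMap.add_apply, LinearMap.smul_apply, LinearMap.sub_apply, smul_eq_mul]
    push_cast
    ring
  refine h1.congr_of_eventuallyEq ?_
  have := eventually_branchIdx_re_eq hg.strictMono (by rw [hg.c_zero]; exact hx.1) h
  rw [← hz0] at this
  filter_upwards [hz.continuousAt.eventually this] with τ hτ
  rw [family, hτ]

end

/-! ### The marked map, its relation times and the local deformation. -/

section

variable {ν : ℕ} {ε : ℝ} {κ : Fin (ν + 1) → ℝ} {s : ℝ} {c : Fin (ν + 2) → ℝ} {g : ℝ → ℝ}

theorem complexMap_iterate_ofReal (hg : IsInClass ε κ s c g) {x : ℝ}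
    (hx : ∀ n, g^[n] x ∈ Icc (-1 : ℝ) 1) (n : ℕ) :
    (complexMap ε κ s c g)^[n] (x : ℂ) = (g^[n] x : ℝ) := by
  induction n with
  | zero => rfl
  | succ n ih => rw [Function.iterate_succ_apply', Function.iterate_succ_apply', ih,
      hg.complexMap_ofReal (hx n)]

theorem IsPrePeriodic.exists_iterate_eq {x : ℝ} (h : IsPrePeriodic g x) :
    ∃ l q, 1 ≤ l ∧ l < q ∧ g^[q] x = g^[l] x := by
  obtain ⟨-, m, n, hn, hper⟩ := h
  refine ⟨m + 1, n + m + 1, by omega, by omega, ?_⟩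
  rw [Function.iterate_succ_apply', Function.iterate_succ_apply', Function.iterate_add_apply, hper]

theorem IsPrePeriodic.finite_orbit {x : ℝ} (h : IsPrePeriodic g x) :
    {y | ∃ k, y = g^[k] x}.Finite := by
  obtain ⟨l, q, -, hlq, hq⟩ := h.exists_iterate_eq
  refine ((Set.finite_Iio q).image fun k => g^[k] x).subset ?_
  rintro _ ⟨k, rfl⟩
  induction k with
  | zero => exact ⟨0, Nat.zero_lt_of_lt hlq, rfl⟩
  | succ k ih =>
    obtain ⟨k', hk', h'⟩ := ih
    simp only at h'
    rw [Function.iterate_succ_apply', ← h', ← Function.iterate_succ_apply' g]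
    rcases (Nat.succ_le_of_lt hk').lt_or_eq with h1 | h1
    · exact ⟨_, h1, rfl⟩
    · rw [h1, hq]; exact ⟨l, hlq, rfl⟩

section
variable (hg : IsInClass ε κ s c g) (hper : ∀ j : Fin ν, IsPrePeriodic g (turn c j))
include hg hper

theorem complexMap_iterate_turnC (j : Fin ν) (n : ℕ) :
    (complexMap ε κ s c g)^[n] (turnC c j) = (g^[n] (turn c j) : ℝ) :=
  complexMap_iterate_ofReal hg (hper j).1 n

theorem isRelationTimes (j : Fin ν) :
    IsRelationTimes g c j (MarkedMap.critTime (complexMap ε κ s c g) (turnC c) j)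
      (MarkedMap.critPreTime (complexMap ε κ s c g) (turnC c) j) := by
  have hiff : ∀ k, (complexMap ε κ s c g)^[k] (turnC c j) ∈ range (turnC c) ↔
      ∃ m, g^[k] (turn c j) = turn c m := by
    intro k
    rw [complexMap_iterate_turnC hg hper, mem_range]
    simp only [turnC, Complex.ofReal_inj]
    exact exists_congr fun m => eq_comm
  by_cases h : ∃ k, 1 ≤ k ∧ (complexMap ε κ s c g)^[k] (turnC c j) ∈ range (turnC c)
  · have hq : MarkedMap.critTime (complexMap ε κ s c g) (turnC c) j =
        sInf {k | 1 ≤ k ∧ (complexMap ε κ s c g)^[k] (turnC c j) ∈ range (turnC c)} := if_pos h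
    have hmem := Nat.sInf_mem (s := {k | 1 ≤ k ∧ (complexMap ε κ s c g)^[k] (turnC c j) ∈
      range (turnC c)}) h
    rw [← hq] at hmem
    refine ⟨hmem.1, fun k hk hkq m hm => ?_, fun hn => absurd ((hiff _).1 hmem.2) hn⟩
    rw [hq] at hkq
    exact Nat.notMem_of_lt_sInf hkq ⟨hk, (hiff k).2 ⟨m, hm⟩⟩
  · have hq : MarkedMap.critTime (complexMap ε κ s c g) (turnC c) j =
        sInf {q | ∃ l, 1 ≤ l ∧ l < q ∧ (complexMap ε κ s c g)^[q] (turnC c j) =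
          (complexMap ε κ s c g)^[l] (turnC c j)} := if_neg h
    have hne : {q | ∃ l, 1 ≤ l ∧ l < q ∧ (complexMap ε κ s c g)^[q] (turnC c j) =
          (complexMap ε κ s c g)^[l] (turnC c j)}.Nonempty := by
      obtain ⟨l, q, hl, hlq, hlq'⟩ := (hper j).exists_iterate_eq
      refine ⟨q, l, hl, hlq, ?_⟩
      rw [complexMap_iterate_turnC hg hper, complexMap_iterate_turnC hg hper, hlq']
    have hmem := Nat.sInf_mem hne
    rw [← hq] at hmem
    have hmem' := Nat.sInf_mem (s := {l | 1 ≤ l ∧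
      l < MarkedMap.critTime (complexMap ε κ s c g) (turnC c) j ∧
      (complexMap ε κ s c g)^[MarkedMap.critTime (complexMap ε κ s c g) (turnC c) j] (turnC c j) =
        (complexMap ε κ s c g)^[l] (turnC c j)}) hmem
    refine ⟨hmem'.1.trans hmem'.2.1.le, fun k hk _ m hm => h ⟨k, hk, (hiff k).2 ⟨m, hm⟩⟩,
      fun _ => ⟨hmem'.1, hmem'.2.1, ?_⟩⟩
    have h' := hmem'.2.2
    rw [← MarkedMap.critPreTime, complexMap_iterate_turnC hg hper,
      complexMap_iterate_turnC hg hper, Complex.ofReal_inj] at h'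
    exact h'

omit hg in
theorem postSet_subset : postSet g c ⊆ Icc (-1) 1 := by
  rintro _ ⟨j, k, rfl⟩
  exact (hper j).1 k

omit hg in
theorem postSet_finite : (postSet g c).Finite := by
  have : postSet g c = ⋃ j, {y | ∃ k, y = g^[k] (turn c j)} := by
    ext; simp [postSet]
  rw [this]
  exact Set.finite_iUnion fun j => (hper j).finite_orbit

omit hg hper in
theorem mem_diff_range_iff {z : ℂ} : z ∈ postSetC g c \ range (turnC c) ↔
    ∃ x ∈ postSet g c, (∀ j, x ≠ turn c j) ∧ (x : ℂ) = z := by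
  constructor
  · rintro ⟨⟨x, hx, rfl⟩, h⟩
    exact ⟨x, hx, fun j hj => h ⟨j, by rw [turnC, hj]⟩, rfl⟩
  · rintro ⟨x, hx, h, rfl⟩
    refine ⟨⟨x, hx, rfl⟩, ?_⟩
    rintro ⟨j, hj⟩
    exact h j (Complex.ofReal_injective hj).symm

variable {ρ : ℝ} (hρ : 0 < ρ)
  (hdisj : ∀ x ∈ postSet g c, ∀ y ∈ postSet g c, x ≠ y → 2 * ρ ≤ |x - y|)
include hρ hdisj

/-- The `2 * ρ` separation keeps each disc off the vertical lines through turning points, so one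
branch formula holds on the whole disc. -/
theorem branchIdx_re_of_mem_nbhd {z : ℂ} (hz : z ∈ nbhd g c ρ) :
    ∃ x ∈ postSet g c, (∀ j, x ≠ turn c j) ∧ z ∈ Metric.ball (x : ℂ) ρ ∧
      ∀ y ∈ Metric.ball (x : ℂ) ρ, branchIdx c y.re = branchIdx c x := by
  simp only [nbhd, mem_iUnion] at hz
  obtain ⟨_, hx, hz⟩ := hz
  obtain ⟨x, hxP, hxt, rfl⟩ := mem_diff_range_iff.1 hx
  refine ⟨x, hxP, hxt, hz, fun y hy => ?_⟩
  refine branchIdx_eq_of_abs_lt hg.strictMono (ρ := ρ)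
    (by rw [hg.c_zero]; exact (postSet_subset hper hxP).1) (fun j => ?_) ?_
  · have := hdisj x hxP (turn c j) ⟨j, 0, rfl⟩ (hxt j)
    linarith
  · rw [mem_ball_iff_norm] at hy
    have := Complex.abs_re_le_norm (y - x)
    simp only [Complex.sub_re, Complex.ofReal_re] at this
    linarith

theorem eventually_branchIdx_of_mem_nbhd {z : ℂ} (hz : z ∈ nbhd g c ρ) :
    ∀ᶠ y in nhds z, branchIdx c y.re = branchIdx c z.re := by
  obtain ⟨x, -, -, hzx, h⟩ := branchIdx_re_of_mem_nbhd hg hper hρ hdisj hz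
  filter_upwards [Metric.isOpen_ball.mem_nhds hzx] with y hy
  rw [h y hy, h z hzx]

theorem isRealMarkedMap (hε : ε = 1 ∨ ε = -1) (hκ : ∀ i, 0 < κ i) :
    MarkedMap.IsRealMarkedMap (complexMap ε κ s c g) (turnC c) (postSetC g c) (nbhd g c ρ) where
  injective := fun _ _ h => hg.turn_strictMono.injective (Complex.ofReal_injective h)
  finite := (postSet_finite hper).image _
  range_subset := by
    rintro _ ⟨j, rfl⟩
    exact ⟨turn c j, ⟨j, 0, rfl⟩, rfl⟩
  mapsTo := by
    rintro _ ⟨x, hx, rfl⟩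
    refine ⟨g x, ?_, (hg.complexMap_ofReal (postSet_subset hper hx)).symm⟩
    obtain ⟨j, k, rfl⟩ := hx
    exact ⟨j, k + 1, (Function.iterate_succ_apply' g k _).symm⟩
  isOpen := isOpen_biUnion fun _ _ => Metric.isOpen_ball
  diff_subset := fun x hx => mem_biUnion hx (Metric.mem_ball_self hρ)
  differentiableOn := by
    intro z hz
    have h1 : DifferentiableAt ℂ (fun y : ℂ => (g (c (branchIdx c z.re).castSucc) : ℂ) +
        ((branchSign ε (branchIdx c z.re) * κ (branchIdx c z.re) * s : ℝ) : ℂ) *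
          (y - (c (branchIdx c z.re).castSucc : ℂ))) z := by fun_prop
    refine (h1.congr_of_eventuallyEq ?_).differentiableWithinAt
    filter_upwards [eventually_branchIdx_of_mem_nbhd hg hper hρ hdisj hz] with y hy
    rw [complexMap, hy]
  deriv_ne_zero := by
    intro z hz
    obtain ⟨x, hx, hxt, rfl⟩ := mem_diff_range_iff.1 hz
    rw [(hasDerivAt_complexMap hg (postSet_subset hper hx) hxt).deriv]
    exact_mod_cast hg.branchSlope_ne_zero hε hκ _
  real_points := by
    rintro _ ⟨x, -, rfl⟩
    exact Complex.ofReal_im x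
  conj_mem := by
    intro z hz
    simp only [nbhd, mem_iUnion] at hz ⊢
    obtain ⟨x, hx, hz⟩ := hz
    refine ⟨x, hx, ?_⟩
    obtain ⟨y, -, -, rfl⟩ := mem_diff_range_iff.1 hx
    rw [mem_ball_iff_norm] at hz ⊢
    rwa [← Complex.conj_ofReal y, ← map_sub, Complex.norm_conj]
  map_conj := fun z _ => complexMap_conj z

theorem isRealLocalHolomorphicDeformation (hε : ε = 1 ∨ ε = -1) (hκ : ∀ i, 0 < κ i)
    {W : Set (Fin ν → ℂ)} (hWo : IsOpen W) (hWc : IsConnected W)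
    (hW : MarkedMap.critVal (complexMap ε κ s c g) (turnC c) ∈ W)
    (hWconj : ∀ w ∈ W, (fun j => (starRingEnd ℂ) (w j)) ∈ W)
    (hWS : ∀ w ∈ W, slope ε κ w ≠ 0) :
    MarkedMap.IsRealLocalHolomorphicDeformation (complexMap ε κ s c g) (turnC c) (nbhd g c ρ)
      (family ε κ c) (turnMap ε κ) W where
  isOpen := hWo
  isConnected := hWc
  critVal_mem := hW
  differentiableOn_p := fun w hw => (differentiableAt_pi.2 fun _ =>
    differentiableAt_partitionPt (hWS w hw) _).differentiableWithinAt
  p_critVal := turnMap_critVal hg hε hκ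
  differentiableOn_G := fun a ha => (differentiableAt_family (hWS a.1 ha.1)
    (eventually_branchIdx_of_mem_nbhd hg hper hρ hdisj ha.2)).differentiableWithinAt
  G_critVal := fun z _ => family_critVal hg hε hκ z
  conj_mem := hWconj
  G_conj := fun w _ z _ => family_conj w z
  p_conj := fun w _ _ => partitionPt_conj w _

end

/-! ### Differentiation of the relation map and transversality. -/

theorem hasDerivAt_critLine (w : Fin ν → ℝ) :
    HasDerivAt (critLine g c w) (fun j => (w j : ℂ)) 0 := by
  rw [hasDerivAt_pi]
  intro j
  simpa [critLine] using ((hasDerivAt_id (0 : ℂ)).mul_const (w j : ℂ)).const_add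
    (g (turn c j) : ℂ)

section
variable (hg : IsInClass ε κ s c g) (hper : ∀ j : Fin ν, IsPrePeriodic g (turn c j))
  (hε : ε = 1 ∨ ε = -1) (hκ : ∀ i, 0 < κ i)
include hg hper hε hκ

theorem family_critVal_iterate (w : Fin ν → ℝ) (j : Fin ν) (n : ℕ) :
    (family ε κ c (critLine g c w 0))^[n] (critLine g c w 0 j) = (g^[n + 1] (turn c j) : ℝ) := by
  have : family ε κ c (critLine g c w 0) = complexMap ε κ s c g := by
    funext z
    rw [← critVal_eq hg, family_critVal hg hε hκ]
  rw [this, ← critVal_eq hg, MarkedMap.critVal, ← Function.iterate_succ_apply,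
    complexMap_iterate_turnC hg hper]

omit hper in
theorem slope_critVal_ne_zero :
    slope ε κ (MarkedMap.critVal (complexMap ε κ s c g) (turnC c)) ≠ 0 := by
  rw [critVal_eq hg 0, slope_critLine hg hε hκ]
  simpa using hg.s_pos.ne'

theorem differentiableAt_family_iterate (j : Fin ν) {n : ℕ}
    (hn : ∀ k, 1 ≤ k → k ≤ n → ∀ m, g^[k] (turn c j) ≠ turn c m) :
    DifferentiableAt ℂ (fun w : Fin ν → ℂ => (family ε κ c w)^[n] (w j))
      (MarkedMap.critVal (complexMap ε κ s c g) (turnC c)) := by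
  induction n with
  | zero => simp only [Function.iterate_zero, id]; fun_prop
  | succ n ih =>
    have ih := ih fun k hk hkn => hn k hk (by omega)
    simp only [Function.iterate_succ_apply']
    have h0 := family_critVal_iterate hg hper hε hκ 0 j n
    rw [← critVal_eq hg] at h0
    have hev := eventually_branchIdx_re_eq hg.strictMono (x := g^[n + 1] (turn c j))
      (by rw [hg.c_zero]; exact ((hper j).1 _).1) (hn (n + 1) (by omega) le_rfl)
    refine DifferentiableAt.comp (g := fun a : (Fin ν → ℂ) × ℂ => family ε κ c a.1 a.2)
      (f := fun w => (w, (family ε κ c w)^[n] (w j))) _ ?_ (differentiableAt_id.prodMk ih)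
    rw [h0]
    exact differentiableAt_family (slope_critVal_ne_zero hg hε hκ) (by simpa using hev)

theorem hasDerivAt_family_iterate (w : Fin ν → ℝ) (j : Fin ν) {n : ℕ}
    (hn : ∀ k, 1 ≤ k → k ≤ n → ∀ m, g^[k] (turn c j) ≠ turn c m) :
    HasDerivAt (fun τ => (family ε κ c (critLine g c w τ))^[n] (critLine g c w τ j))
      ((orbitMult ε κ s c g j n * orbitForm ε κ s c g 1 j n w : ℝ) : ℂ) 0 := by
  induction n with
  | zero =>
    simpa [orbitMult, orbitForm] using hasDerivAt_pi.1 (hasDerivAt_critLine w) j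
  | succ n ih =>
    have ih := ih fun k hk hkn => hn k hk (by omega)
    simp only [Function.iterate_succ_apply']
    refine (hasDerivAt_family_critLine hg hε hκ w ((hper j).1 (n + 1))
      (hn (n + 1) (by omega) le_rfl) ih
      (family_critVal_iterate hg hper hε hκ w j n)).congr_deriv ?_
    congr 1
    have h1 := orbitMult_ne_zero hg hε hκ j (n + 1)
    rw [orbitForm_succ_apply, one_pow, mul_add, ← mul_assoc _ (1 / _), mul_one_div_cancel h1,
      orbitMult_succ]
    ring

omit hε hκ in
theorem hasDerivAt_complexMap_iterate (j : Fin ν) {n : ℕ}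
    (hn : ∀ k, 1 ≤ k → k ≤ n → ∀ m, g^[k] (turn c j) ≠ turn c m) :
    HasDerivAt (complexMap ε κ s c g)^[n] (orbitMult ε κ s c g j n : ℂ)
      (MarkedMap.critVal (complexMap ε κ s c g) (turnC c) j) := by
  induction n with
  | zero => simpa [orbitMult] using hasDerivAt_id _
  | succ n ih =>
    have ih := ih fun k hk hkn => hn k hk (by omega)
    rw [Function.iterate_succ', orbitMult_succ, Complex.ofReal_mul, mul_comm]
    refine HasDerivAt.comp _ ?_ ih
    rw [MarkedMap.critVal, ← Function.iterate_succ_apply, complexMap_iterate_turnC hg hper]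
    exact hasDerivAt_complexMap hg ((hper j).1 _) (hn (n + 1) (by omega) le_rfl)

omit hε hκ in
theorem complexMap_iterate_eq_iff (j m : Fin ν) (n : ℕ) :
    (complexMap ε κ s c g)^[n] (turnC c j) = turnC c m ↔ g^[n] (turn c j) = turn c m := by
  rw [complexMap_iterate_turnC hg hper, turnC, Complex.ofReal_inj]

omit hε hκ in
/-- The relation map with the dynamical conditions expressed through the real map. -/
theorem relationMap_apply (w : Fin ν → ℂ) (j : Fin ν) {q l : ℕ}
    (hq : q = MarkedMap.critTime (complexMap ε κ s c g) (turnC c) j)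
    (hl : l = MarkedMap.critPreTime (complexMap ε κ s c g) (turnC c) j) :
    (∀ h : ∃ m, g^[q] (turn c j) = turn c m,
      MarkedMap.relationMap (complexMap ε κ s c g) (turnC c) (family ε κ c) (turnMap ε κ) w j =
        (family ε κ c w)^[q - 1] (w j) - turnMap ε κ w h.choose) ∧
    ((¬ ∃ m, g^[q] (turn c j) = turn c m) →
      MarkedMap.relationMap (complexMap ε κ s c g) (turnC c) (family ε κ c) (turnMap ε κ) w j =
        (family ε κ c w)^[q - 1] (w j) - (family ε κ c w)^[l - 1] (w j)) := by
  subst hq hl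
  constructor
  · intro h
    have h' : ∃ m, (complexMap ε κ s c g)^[MarkedMap.critTime (complexMap ε κ s c g) (turnC c) j]
        (turnC c j) = turnC c m := by
      simpa only [complexMap_iterate_eq_iff hg hper] using h
    rw [MarkedMap.relationMap, dif_pos h']
    congr 2
    -- The chosen indices for the complex and the real relation agree because turning points are
    -- distinct.
    refine hg.turn_strictMono.injective ?_
    rw [← h.choose_spec]
    exact ((complexMap_iterate_eq_iff hg hper _ _ _).1 h'.choose_spec).symm
  · intro h
    rw [MarkedMap.relationMap, dif_neg]
    simpa only [complexMap_iterate_eq_iff hg hper] using h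

theorem differentiableAt_relationMap :
    DifferentiableAt ℂ (MarkedMap.relationMap (complexMap ε κ s c g) (turnC c) (family ε κ c)
      (turnMap ε κ)) (MarkedMap.critVal (complexMap ε κ s c g) (turnC c)) := by
  rw [differentiableAt_pi]
  intro j
  have hq := isRelationTimes hg hper j
  have h1 := differentiableAt_family_iterate hg hper hε hκ j
    (n := MarkedMap.critTime (complexMap ε κ s c g) (turnC c) j - 1)
    fun k hk hkn => hq.ne_turn k hk (by have := hq.one_le; omega)
  by_cases h : ∃ m, g^[MarkedMap.critTime (complexMap ε κ s c g) (turnC c) j] (turn c j) = turn c m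
  · simp only [(relationMap_apply hg hper _ j rfl rfl).1 h]
    exact h1.sub (differentiableAt_partitionPt (slope_critVal_ne_zero hg hε hκ) _)
  · simp only [(relationMap_apply hg hper _ j rfl rfl).2 h]
    have hp := hq.pre h
    exact h1.sub (differentiableAt_family_iterate hg hper hε hκ j
      fun k hk hkn => hq.ne_turn k hk (by omega))

theorem hasDerivAt_relationMap (w : Fin ν → ℝ) (j : Fin ν) :
    HasDerivAt (fun τ => MarkedMap.relationMap (complexMap ε κ s c g) (turnC c) (family ε κ c)
      (turnMap ε κ) (critLine g c w τ) j)
      ((orbitMult ε κ s c g j (MarkedMap.critTime (complexMap ε κ s c g) (turnC c) j - 1) *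
        relationForm ε κ s c g (MarkedMap.critTime (complexMap ε κ s c g) (turnC c))
          (MarkedMap.critPreTime (complexMap ε κ s c g) (turnC c)) 1 j w : ℝ) : ℂ) 0 := by
  have hq := isRelationTimes hg hper j
  have h1 := hasDerivAt_family_iterate hg hper hε hκ w j
    (n := MarkedMap.critTime (complexMap ε κ s c g) (turnC c) j - 1)
    fun k hk hkn => hq.ne_turn k hk (by have := hq.one_le; omega)
  have hD := orbitMult_ne_zero hg hε hκ j
    (MarkedMap.critTime (complexMap ε κ s c g) (turnC c) j - 1)
  by_cases h : ∃ m, g^[MarkedMap.critTime (complexMap ε κ s c g) (turnC c) j] (turn c j) = turn c m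
  · simp only [(relationMap_apply hg hper _ j rfl rfl).1 h]
    refine (h1.sub (hasDerivAt_partitionPt_critLine hg hε hκ w _)).congr_deriv ?_
    rw [relationForm, dif_pos h, ← Complex.ofReal_sub]
    congr 1
    simp only [LinearMap.sub_apply, LinearMap.smul_apply, smul_eq_mul, one_pow]
    field_simp
  · simp only [(relationMap_apply hg hper _ j rfl rfl).2 h]
    have hp := hq.pre h
    refine (h1.sub (hasDerivAt_family_iterate hg hper hε hκ w j
      fun k hk hkn => hq.ne_turn k hk (by omega))).congr_deriv ?_
    rw [relationForm, dif_neg h, ← Complex.ofReal_sub]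
    congr 1
    simp only [LinearMap.sub_apply, LinearMap.smul_apply, smul_eq_mul, one_pow, one_mul]
    field_simp

/-- The basis directions are real, so each entry is a derivative along some `critLine`, and
uniqueness of derivatives identifies it. -/
theorem jacobian_apply (j k : Fin ν) :
    MarkedMap.jacobian (complexMap ε κ s c g) (turnC c) (family ε κ c) (turnMap ε κ) j k =
      ((orbitMult ε κ s c g j (MarkedMap.critTime (complexMap ε κ s c g) (turnC c) j - 1) *
        relationForm ε κ s c g (MarkedMap.critTime (complexMap ε κ s c g) (turnC c))
          (MarkedMap.critPreTime (complexMap ε κ s c g) (turnC c)) 1 j (Pi.single k 1) : ℝ) : ℂ) := by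
  have h1 := (differentiableAt_relationMap hg hper hε hκ).hasFDerivAt
  have h2 := hasDerivAt_critLine (g := g) (c := c) (Pi.single k (1 : ℝ))
  have e : (fun i => ((Pi.single k (1 : ℝ) : Fin ν → ℝ) i : ℂ)) = Pi.single k (1 : ℂ) := by
    funext i
    by_cases hi : i = k
    · subst hi; simp
    · simp [hi]
  rw [e] at h2
  rw [critVal_eq hg (Pi.single k 1)] at h1
  have h3 := hasDerivAt_pi.1 (h1.comp_hasDerivAt (0 : ℂ) h2) j
  rw [MarkedMap.jacobian, Matrix.of_apply, critVal_eq hg (Pi.single k 1)]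
  exact h3.unique (hasDerivAt_relationMap hg hper hε hκ (Pi.single k 1) j)

theorem positivelyOrientedTransversal (herg : IsErgodic g) :
    MarkedMap.PositivelyOrientedTransversal (complexMap ε κ s c g) (turnC c) (family ε κ c)
      (turnMap ε κ) := by
  have hqs := isRelationTimes hg hper
  have hpos := det_relationForm_pos hg hε hκ herg hqs fun j n => (hper j).1 n
  have hratio : MarkedMap.transversalityRatio (complexMap ε κ s c g) (turnC c) (family ε κ c)
      (turnMap ε κ) = ((Matrix.of fun j k => relationForm ε κ s c g
        (MarkedMap.critTime (complexMap ε κ s c g) (turnC c))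
        (MarkedMap.critPreTime (complexMap ε κ s c g) (turnC c)) 1 j
          (Pi.single k 1)).det : ℝ) := by
    have hprod : ∏ j, deriv (complexMap ε κ s c g)^[MarkedMap.critTime (complexMap ε κ s c g)
        (turnC c) j - 1] (MarkedMap.critVal (complexMap ε κ s c g) (turnC c) j) =
        ((∏ j, orbitMult ε κ s c g j
          (MarkedMap.critTime (complexMap ε κ s c g) (turnC c) j - 1) : ℝ) : ℂ) := by
      rw [Complex.ofReal_prod]
      refine Finset.prod_congr rfl fun j _ => ?_
      exact (hasDerivAt_complexMap_iterate hg hper j fun k hk hkn =>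
        (hqs j).ne_turn k hk (by have := (hqs j).one_le; omega)).deriv
    have hjac : MarkedMap.jacobian (complexMap ε κ s c g) (turnC c) (family ε κ c)
        (turnMap ε κ) = (Matrix.of fun j k => orbitMult ε κ s c g j
          (MarkedMap.critTime (complexMap ε κ s c g) (turnC c) j - 1) *
            Matrix.of (fun j k => relationForm ε κ s c g
              (MarkedMap.critTime (complexMap ε κ s c g) (turnC c))
              (MarkedMap.critPreTime (complexMap ε κ s c g) (turnC c)) 1 j
                (Pi.single k 1)) j k).map Complex.ofRealHom := by
      ext j k
      rw [jacobian_apply hg hper hε hκ]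
      rfl
    -- The row factors pulled out of the determinant are exactly the multipliers in the denominator.
    rw [MarkedMap.transversalityRatio, hprod, hjac, ← RingHom.mapMatrix_apply,
      ← RingHom.map_det, Matrix.det_mul_column, Complex.ofRealHom_eq_coe, ← Complex.ofReal_div,
      mul_div_cancel_left₀]
    exact Finset.prod_ne_zero_iff.2 fun j _ => orbitMult_ne_zero hg hε hκ j _
  refine ⟨differentiableAt_relationMap hg hper hε hκ, ?_, ?_⟩
  · rw [hratio, Complex.ofReal_im]
  · rw [hratio, Complex.ofReal_re]; exact hpos

end

end

end PiecewiseLinear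

end

theorem mainTheorem11 (ν : ℕ) (hν : 1 ≤ ν) (ε : ℝ) (hε : ε = 1 ∨ ε = -1)
    (κ : Fin (ν + 1) → ℝ) (hκ : ∀ i, 0 < κ i)
    (g : ℝ → ℝ) (s : ℝ) (c : Fin (ν + 2) → ℝ)
    (hg : PiecewiseLinear.IsInClass ε κ s c g)
    (hper : ∀ j : Fin ν, PiecewiseLinear.IsPrePeriodic g (PiecewiseLinear.turn c j))
    (herg : PiecewiseLinear.IsErgodic g)
    (ρ : ℝ) (hρ : 0 < ρ)
    (hdisj : ∀ x ∈ PiecewiseLinear.postSet g c, ∀ y ∈ PiecewiseLinear.postSet g c,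
      x ≠ y → 2 * ρ ≤ |x - y|)
    (W : Set (Fin ν → ℂ)) (hWo : IsOpen W) (hWc : IsConnected W)
    (hW : MarkedMap.critVal (PiecewiseLinear.complexMap ε κ s c g) (PiecewiseLinear.turnC c) ∈ W)
    (hWconj : ∀ w ∈ W, (fun j => (starRingEnd ℂ) (w j)) ∈ W)
    (hWS : ∀ w ∈ W, PiecewiseLinear.slope ε κ w ≠ 0) :
    MarkedMap.IsRealMarkedMap (PiecewiseLinear.complexMap ε κ s c g) (PiecewiseLinear.turnC c)
        (PiecewiseLinear.postSetC g c) (PiecewiseLinear.nbhd g c ρ) ∧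
      MarkedMap.IsRealLocalHolomorphicDeformation (PiecewiseLinear.complexMap ε κ s c g)
        (PiecewiseLinear.turnC c) (PiecewiseLinear.nbhd g c ρ)
        (PiecewiseLinear.family ε κ c) (PiecewiseLinear.turnMap ε κ) W ∧
      MarkedMap.PositivelyOrientedTransversal (PiecewiseLinear.complexMap ε κ s c g)
        (PiecewiseLinear.turnC c) (PiecewiseLinear.family ε κ c)
        (PiecewiseLinear.turnMap ε κ) := by
  exact ⟨PiecewiseLinear.isRealMarkedMap hg hper hρ hdisj hε hκ,
    PiecewiseLinear.isRealLocalHolomorphicDeformation hg hper hρ hdisj hε hκ hWo hWc hW hWconj hWS,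
    PiecewiseLinear.positivelyOrientedTransversal hg hper hε hκ herg⟩
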